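/- Let $f\in\mathbb{Z}[x]$ be a polynomial of degree $2$, and let $f^n$ denote its iterates: $f^0(x)=x$ and $f^{n+1}(x)=f(f^n(x))$. Then the series $\sum_{n=0}^\infty \frac{1}{f^n(x)}$ converges in the field $\mathbb{Q}((1/x))$ of formal Laurent series in $1/x$. Its sum has a specializable continued fraction if and only if $f(x)=kx^2$ for some integer $k$, or $f(x)=kx^2-x$ for some integer $k$, or $f(x)$ is one of $$x^2-x+1,\qquad x^2-2x+1,\qquad -x^2-x-1,\qquad -x^2-2x-1 .$$ Here $S\in\mathbb{Q}((1/x))$ is said to have a specializable continued fraction if there is a finite or infinite continued fraction $[a_0,a_1,a_2,\dots]=a_0+\cfrac{1}{a_1+\cfrac{1}{a_2+\cdots}}$ with value $S$ all of whose partial quotients $a_i$ lie in $\mathbb{Z}[x]$ (constants, including $0$, are allowed). Its value is its last convergent if it is finite, and the limit of its convergents $p_n/q_n$ in $\mathbb{Q}((1/x))$ if it is infinite. In the finite case the last $q_n$ must be non-zero, and in the infinite case $q_n$ must be non-zero for all large $n$. -/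

import Mathlib

open Polynomial Filter Topology
open scoped LaurentSeries

noncomputable section

/-- The embedding of `ℤ[x]` into the field of formal Laurent series in `1/x` over `ℚ`. This field is
`ℚ⸨X⸩` with `X` in the role of `1/x`, so the polynomial variable `x` goes to the monomial `X⁻¹`.
A topology on `ℚ⸨X⸩` is always that of the `X`-adic valuation, i.e. of the degree in `x`. -/
def atInfinity : ℤ[X] →ₐ[ℤ] ℚ⸨X⸩ :=
  Polynomial.aeval (HahnSeries.single (-1 : ℤ) (1 : ℚ) : ℚ⸨X⸩)

/-- The `n`-th iterate of the polynomial `f` under composition: `f⁰(x) = x` and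
`fⁿ⁺¹(x) = f(fⁿ(x))`. -/
def polyIterate (f : ℤ[X]) (n : ℕ) : ℤ[X] :=
  (fun p : ℤ[X] => f.comp p)^[n] X

/-- The `n`-th term `1 / fⁿ(x)` of the series, as a formal Laurent series in `1/x`. -/
def iterTerm (f : ℤ[X]) (n : ℕ) : ℚ⸨X⸩ :=
  1 / atInfinity (polyIterate f n)

/-- `S` has a specializable continued fraction: there is a finite or infinite continued fraction
`[a₀, a₁, a₂, …]` (all partial numerators are `1`) with every partial quotient in `ℤ[x]`, and its
value is `S`. The partial quotients may be constant, or zero. The value is the limit of the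
convergents `pₙ / qₙ`, where `qₙ ≠ 0` for all large `n`; the sequence of convergents of a finite
continued fraction is eventually constant, so that its limit is the last convergent. -/
def HasSpecializableContFract (S : ℚ⸨X⸩) : Prop :=
  ∃ g : SimpContFract ℚ⸨X⸩,
    g.1.h ∈ Set.range atInfinity ∧
    (∀ (n : ℕ) (a : ℚ⸨X⸩), g.1.partDens.get? n = some a → a ∈ Set.range atInfinity) ∧
    (∀ᶠ n in atTop, g.1.dens n ≠ 0) ∧
    Tendsto (fun n : ℕ => g.1.convs n) atTop (𝓝 S)

end

/-! Necessity rests on one obstruction. If p/q is a finite continued fraction with partial quotients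
in ℤ[x], constants allowed, then the polynomial part of p/q is integral except possibly in its
constant term (`IsContinuant.exists_polynomial_part`). The reason is a normal form: runs of constant
quotients multiply to elements of GL₂(ℤ), so p/q = h + (aP + bQ)/(cP + dQ) with deg Q < deg P, whose
polynomial part is h + a/c. Left multiplication by the inverse of an integral quotient matrix keeps
a pair a continuant. Hence the same integrality holds for whatever remains of S after integral
quotients are stripped from it (`iterates_dvd_coeff_strip`), and a few terms of the series already
determine the polynomial part of that remainder. For f = ax² + bx + c the remainders have leading
denominators b + 1 and then ac - 1 or its square. This forces b ∈ {0, -1, -2} and ac ∈ {0, 1, 2}.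
Each surviving polynomial outside the list produces a denominator 3, 4 or 9 a little later.

For sufficiency, partial sums or nearby approximations are realised as words of quotients extending
one another. A word without zeros and without adjacent constants has convergents that converge
(`IsRegularSeq.hasSpecializable`). For kx² the folding lemma turns a word w into w, -k, -wᵣ and adds
1/(kq²). For kx² - x each further term costs one further quotient, since products of consecutive
denominators are iterates up to sign. For e(x² + 1) - x with e = ±1 the series telescopes to 1/(x -
e). For e(x - e)² one rescales to yₙ₊₁ = (yₙ - 1)² and uses words that contain mirrored copies of
earlier words (`shiftMat`); their values differ from the partial sums by an explicit null sequence.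
-/

noncomputable section

/-! ### Valuation and convergence in the field of Laurent series in 1/x -/

open WithZero in
theorem val_intCast {n : ℤ} (hn : n ≠ 0) :
    (Valued.v ((n : ℤ) : ℚ⸨X⸩) : WithZero (Multiplicative ℤ)) = 1 := by
  have h1 : ∀ m : ℚ, (Valued.v (HahnSeries.C m : ℚ⸨X⸩) : WithZero (Multiplicative ℤ)) ≤ 1 := by
    intro m
    have := (LaurentSeries.valuation_le_iff_coeff_lt_eq_zero ℚ (D := 0)
      (f := (HahnSeries.C m : ℚ⸨X⸩))).2 (fun k hk => HahnSeries.coeff_single_of_ne hk.ne)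
    simpa using this
  have h2 : ((n : ℤ) : ℚ⸨X⸩) = HahnSeries.C (n : ℚ) := by simp
  have hq : (n : ℚ) ≠ 0 := by exact_mod_cast hn
  rw [h2]
  refine le_antisymm (h1 _) ?_
  have h3 : (Valued.v (HahnSeries.C (n : ℚ) : ℚ⸨X⸩) : WithZero (Multiplicative ℤ)) *
      Valued.v (HahnSeries.C ((n : ℚ)⁻¹) : ℚ⸨X⸩) = 1 := by
    rw [← map_mul, ← map_mul, mul_inv_cancel₀ hq, map_one, map_one]
  rw [← h3]
  exact mul_le_of_le_one_right' (h1 _)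

open WithZero in
theorem val_atInfinity {p : ℤ[X]} (hp : p ≠ 0) :
    (Valued.v (atInfinity p) : WithZero (Multiplicative ℤ)) = exp (p.natDegree : ℤ) := by
  have hmon : ∀ (n : ℕ) (a : ℤ), a ≠ 0 →
      (Valued.v (atInfinity (C a * X ^ n)) : WithZero (Multiplicative ℤ)) = exp (n : ℤ) := by
    intro n a ha
    have : atInfinity (C a * X ^ n) =
        ((a : ℤ) : ℚ⸨X⸩) * (HahnSeries.single (-1 : ℤ) (1 : ℚ) : ℚ⸨X⸩) ^ n := by
      simp [atInfinity]
    rw [this, map_mul, map_pow, val_intCast ha, LaurentSeries.valuation_single_zpow, one_mul,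
      ← exp_nsmul]
    simp
  induction h : p.natDegree using Nat.strong_induction_on generalizing p with
  | _ d ih =>
    have hl := p.eraseLead_add_C_mul_X_pow
    have hlc : p.leadingCoeff ≠ 0 := leadingCoeff_ne_zero.2 hp
    by_cases h0 : p.eraseLead = 0
    · rw [← hl, h0, zero_add, hmon _ _ hlc, h]
    · have hlt : p.eraseLead.natDegree < d := by
        rw [← h]
        refine eraseLead_natDegree_lt_or_eraseLead_eq_zero p |>.resolve_right h0
      rw [← hl, map_add, Valuation.map_add_eq_of_lt_right, hmon _ _ hlc, h]
      rw [ih _ hlt h0 rfl, hmon _ _ hlc, exp_lt_exp, h]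
      exact_mod_cast hlt

theorem atInfinity_injective : Function.Injective atInfinity := by
  rw [injective_iff_map_eq_zero]
  intro p hp
  by_contra h
  have := val_atInfinity h
  rw [hp, map_zero] at this
  exact WithZero.exp_ne_zero this.symm

theorem atInfinity_ne_zero {p : ℤ[X]} (hp : p ≠ 0) : atInfinity p ≠ 0 := by
  rwa [Ne, map_eq_zero_iff _ atInfinity_injective]

open WithZero in
theorem val_atInfinity_le {p : ℤ[X]} {n : ℤ} (h : (p.natDegree : ℤ) ≤ n) :
    (Valued.v (atInfinity p) : WithZero (Multiplicative ℤ)) ≤ exp n := by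
  by_cases hp : p = 0
  · simp [hp]
  · rw [val_atInfinity hp]
    simpa using h

-- Turns limits into degree estimates: convergence means agreement to arbitrarily high order in 1/x.
open WithZero in
theorem tendsto_nhds_iff_val {ι : Type*} {l : Filter ι} {u : ι → ℚ⸨X⸩} {S : ℚ⸨X⸩} :
    Tendsto u l (𝓝 S) ↔
      ∀ K : ℕ, ∀ᶠ i in l, (Valued.v (u i - S) : WithZero (Multiplicative ℤ)) ≤ exp (-(K : ℤ)) := by
  constructor
  · intro h K
    have h' : Tendsto (fun i => u i - S) l (𝓝 0) := by simpa using h.sub_const S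
    refine h'.eventually (p := fun y => (Valued.v y : WithZero (Multiplicative ℤ)) ≤ _) ?_
    refine Valued.mem_nhds_zero.2 ?_
    refine ⟨Units.mk0 ((Valued.v : Valuation ℚ⸨X⸩ _).restrict
      (HahnSeries.single (K : ℤ) (1 : ℚ) : ℚ⸨X⸩)) ?_, ?_⟩
    · simp
    · intro y hy
      have := (Valuation.restrict_lt_iff _).1 hy
      rw [LaurentSeries.valuation_single_zpow] at this
      exact this.le
  · intro h
    rw [tendsto_def]
    intro s hs
    obtain ⟨γ, hγ⟩ := Valued.mem_nhds.1 hs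
    set g := MonoidWithZeroHom.ValueGroup₀.embedding γ.1 with hg
    have hg0 : g ≠ 0 := by simp [hg]
    have key : ∃ K : ℕ, exp (-(K : ℤ)) < g := by
      refine ⟨(1 - log g).toNat, ?_⟩
      rw [← exp_log hg0, exp_lt_exp]
      have := Int.self_le_toNat (1 - log g)
      simp only [log_exp]
      omega
    obtain ⟨K, hK⟩ := key
    filter_upwards [h K] with i hi
    refine hγ ?_
    show (Valued.v : Valuation ℚ⸨X⸩ _).restrict (u i - S) < γ.1
    rw [Valuation.restrict_lt_iff_lt_embedding]
    exact lt_of_le_of_lt hi hK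

/-! ### Continuants over ℤ[x] and their normal form -/

/-- `IsContinuant p q` says that `p / q` is the value of a finite continued fraction with
partial quotients in `ℤ[x]`, where `(p, q)` is the pair computed by the usual recursion. -/
inductive IsContinuant : ℤ[X] → ℤ[X] → Prop
  | base : IsContinuant 1 0
  | step (a : ℤ[X]) {p q : ℤ[X]} : IsContinuant p q → IsContinuant (a * p + q) p

theorem IsContinuant.swap {p q : ℤ[X]} (h : IsContinuant p q) : IsContinuant q p := by
  simpa using h.step 0

theorem IsContinuant.sub_mul {p q : ℤ[X]} (l : ℤ[X]) (h : IsContinuant p q) :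
    IsContinuant q (p - l * q) := by
  have := (h.swap.step (-l)).swap
  rwa [show -l * q + p = p - l * q by ring] at this

/-- A normal form for pairs of continuants: a regular continued fraction interlaced with
elements of `GL₂(ℤ)`. -/
inductive IsNormalPair : ℤ[X] → ℤ[X] → Prop
  | unit (e : ℤ) (he : e = 1 ∨ e = -1) : IsNormalPair (C e) 0
  | step (p q h : ℤ[X]) (a b c d : ℤ) : IsNormalPair p q → q.degree < p.degree → c ≠ 0 →
      (a * d - b * c = 1 ∨ a * d - b * c = -1) →
      IsNormalPair (C a * p + C b * q + h * (C c * p + C d * q)) (C c * p + C d * q)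

theorem degree_C_mul_add_C_mul {p q : ℤ[X]} {c d : ℤ} (hlt : q.degree < p.degree) (hc : c ≠ 0) :
    (C c * p + C d * q).degree = p.degree := by
  have h1 : (C c * p).degree = p.degree := degree_C_mul hc
  have h2 : (C d * q).degree < p.degree := by
    rcases eq_or_ne d 0 with rfl | hd
    · simpa using lt_of_le_of_lt bot_le hlt
    · rwa [degree_C_mul hd]
  rw [degree_add_eq_left_of_degree_lt (by rwa [h1]), h1]

/-- Signs can be absorbed into the GL₂(ℤ) block, and the multiple of `q` into `h`. Together with
`swap` this gives closure under prepending any quotient. -/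
theorem IsNormalPair.signs {p q : ℤ[X]} (hr : IsNormalPair p q) (s t : ℤ) (l : ℤ[X])
    (hs : s = 1 ∨ s = -1) (ht : t = 1 ∨ t = -1) :
    IsNormalPair (C s * p + l * q) (C t * q) := by
  cases hr with
  | unit e he =>
    have := IsNormalPair.unit (s * e) (by rcases hs with rfl | rfl <;> rcases he with rfl | rfl <;> simp)
    simpa using this
  | step p q h a b c d hr hlt hc hdet =>
    have htt : t * t = 1 := by rcases ht with rfl | rfl <;> rfl
    have := IsNormalPair.step p q (C (s * t) * h + C t * l) (s * a) (s * b) (t * c) (t * d) hr hlt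
      (by rcases ht with rfl | rfl <;> simpa using hc)
      (by rcases hs with rfl | rfl <;> rcases ht with rfl | rfl <;> rcases hdet with h | h <;>
        first
          | (left; linarith)
          | (right; linarith))
    have hC : (C t * C t : ℤ[X]) = 1 := by rw [← C_mul, htt, C_1]
    convert this using 1
    · simp only [C_mul]
      linear_combination (-(C s * h + l) * (C c * p + C d * q)) * hC
    · simp only [C_mul]
      ring

theorem IsNormalPair.swap {p q : ℤ[X]} (hr : IsNormalPair p q) : IsNormalPair q p := by
  cases hr with
  | unit e he =>
    have := IsNormalPair.step (C e) 0 0 0 1 1 0 (.unit e he)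
      (by rcases he with rfl | rfl <;> simp) one_ne_zero (by simp)
    simpa using this
  | step p q h a b c d hr hlt hc hdet =>
    have hdeg := degree_C_mul_add_C_mul (d := d) hlt hc
    -- A constant `h` is merged into the integral matrix. A non-constant `h` makes the degree drop
    -- strictly, so a new block with the swap matrix can start.
    by_cases hh : h.natDegree = 0
    · obtain ⟨n, rfl⟩ := natDegree_eq_zero.1 hh
      -- Here the entry that must be non-zero in the merged matrix vanishes. The determinant then
      -- forces `c` and `b + n * d` to be ±1, and the block collapses into a sign change of the
      -- preceding pair.
      by_cases hn : a + n * c = 0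
      · have h1 : c * (-(n * d) - b) = 1 ∨ c * (-(n * d) - b) = -1 := by
          have : c * (-(n * d) - b) = a * d - b * c := by linear_combination -d * hn
          rwa [this]
        have hc1 : c = 1 ∨ c = -1 := by
          rcases h1 with h1 | h1
          · exact Int.isUnit_iff.1 (IsUnit.of_mul_eq_one _ h1)
          · exact Int.isUnit_iff.1 (IsUnit.of_mul_eq_one (-(-(n * d) - b)) (by linarith))
        have hd1 : b + n * d = 1 ∨ b + n * d = -1 := by
          rcases h1 with h1 | h1 <;> rcases hc1 with rfl | rfl
          · right; linarith
          · left; linarith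
          · left; linarith
          · right; linarith
        have := hr.signs c (b + n * d) (C d) hc1 hd1
        convert this using 1
        have ha : (C a : ℤ[X]) + C n * C c = 0 := by rw [← C_mul, ← C_add, hn, C_0]
        rw [C_add, C_mul]
        linear_combination p * ha
      · have := IsNormalPair.step p q 0 c d (a + n * c) (b + n * d) hr hlt hn (by
          have : c * (b + n * d) - d * (a + n * c) = -(a * d - b * c) := by ring
          rw [this]
          rcases hdet with h | h <;> simp [h])
        convert this using 1
        · ring
        · simp only [C_add, C_mul]; ring
    · set Q := C c * p + C d * q with hQ
      have hp0 : p ≠ 0 := by rintro rfl; simp at hlt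
      have hQ0 : Q ≠ 0 := by
        intro h0; rw [h0, degree_zero] at hdeg; exact hp0 (degree_eq_bot.1 hdeg.symm)
      have hh0 : h ≠ 0 := by rintro rfl; simp at hh
      have hlt2 : Q.degree < (C a * p + C b * q + h * Q).degree := by
        have hle : (C a * p + C b * q).degree ≤ Q.degree := by
          rw [hdeg]
          refine (degree_add_le _ _).trans (max_le ?_ ?_)
          · refine (degree_mul_le _ _).trans ?_
            calc (C a).degree + p.degree ≤ 0 + p.degree := by gcongr; exact degree_C_le
              _ = _ := zero_add _
          · refine (degree_mul_le _ _).trans ?_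
            calc (C b).degree + q.degree ≤ 0 + q.degree := by gcongr; exact degree_C_le
              _ = q.degree := zero_add _
              _ ≤ _ := hlt.le
        have hlt3 : Q.degree < (h * Q).degree := by
          rw [degree_eq_natDegree hQ0, degree_eq_natDegree (mul_ne_zero hh0 hQ0),
            natDegree_mul hh0 hQ0]
          exact_mod_cast (by omega : Q.natDegree < h.natDegree + Q.natDegree)
        rwa [degree_add_eq_right_of_degree_lt (lt_of_le_of_lt hle hlt3)]
      have := IsNormalPair.step (C a * p + C b * q + h * Q) Q 0 0 1 1 0
        (.step p q h a b c d hr hlt hc hdet) hlt2 one_ne_zero (by simp)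
      simpa using this

theorem IsContinuant.isNormalPair {p q : ℤ[X]} (h : IsContinuant p q) : IsNormalPair p q := by
  induction h with
  | base => simpa using IsNormalPair.unit 1 (Or.inl rfl)
  | @step a p q _ ih => simpa [add_comm] using ih.swap.signs 1 1 a (Or.inl rfl) (Or.inl rfl)

/-- The polynomial part of the value of a continued fraction with partial quotients in `ℤ[x]` has
integral coefficients, except possibly for its constant term. -/
theorem IsContinuant.exists_polynomial_part {p q : ℤ[X]} (h : IsContinuant p q) (hq : q ≠ 0) :
    ∃ (c a : ℤ) (l : ℤ[X]), c ≠ 0 ∧ (C c * p - (C c * l + C a) * q).degree < q.degree := by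
  cases h.isNormalPair with
  | unit e he => exact absurd rfl hq
  | step p q l a b c d hr hlt hc hdet =>
    refine ⟨c, a, l, hc, ?_⟩
    rw [degree_C_mul_add_C_mul hlt hc]
    rw [show C c * (C a * p + C b * q + l * (C c * p + C d * q)) -
      (C c * l + C a) * (C c * p + C d * q) = C (c * b - a * d) * q by simp only [C_mul, C_sub]; ring]
    refine lt_of_le_of_lt (degree_mul_le _ _) ?_
    calc (C (c * b - a * d)).degree + q.degree ≤ 0 + q.degree := by gcongr; exact degree_C_le
      _ = q.degree := zero_add _
      _ < _ := hlt

/-- If `p / q` is the value of an integral continued fraction and `A / m` agrees with `p / q` up to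
a bounded error, then `A / m` has integral coefficients outside its constant term. -/
theorem IsContinuant.dvd_coeff {p q A : ℤ[X]} {m : ℤ} (h : IsContinuant p q) (hq : q ≠ 0)
    (hA : (C m * p - A * q).degree ≤ q.degree) {j : ℕ} (hj : 0 < j) : m ∣ A.coeff j := by
  obtain ⟨c, a, l, hc, hlt⟩ := h.exists_polynomial_part hq
  -- Both A/m and l + a/c are polynomial parts of p/q up to O(1), so after clearing denominators `C
  -- c * A - C m * (C c * l)` must be constant.
  have h1 : ((C c * A - C m * (C c * l)) * q).degree ≤ q.degree := by
    rw [show (C c * A - C m * (C c * l)) * q =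
      C m * (C c * p - (C c * l + C a) * q) - C c * (C m * p - A * q) + C (m * a) * q by
        simp only [C_mul]; ring]
    have hC : ∀ (n : ℤ) (r : ℤ[X]), r.degree ≤ q.degree → (C n * r).degree ≤ q.degree := by
      intro n r hr
      refine (degree_mul_le _ _).trans ?_
      calc (C n).degree + r.degree ≤ 0 + r.degree := by gcongr; exact degree_C_le
        _ = r.degree := zero_add _
        _ ≤ _ := hr
    exact (degree_add_le _ _).trans (max_le ((degree_sub_le _ _).trans
      (max_le (hC _ _ hlt.le) (hC _ _ hA))) (hC _ _ le_rfl))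
  have h2 : (C c * A - C m * (C c * l)).natDegree = 0 := by
    by_contra h0
    have hne : C c * A - C m * (C c * l) ≠ 0 := by intro h; rw [h] at h0; simp at h0
    have := natDegree_le_natDegree h1
    rw [natDegree_mul hne hq] at this
    omega
  have h3 := coeff_eq_zero_of_natDegree_lt (h2.trans_lt hj)
  rw [coeff_sub, coeff_C_mul, coeff_C_mul, coeff_C_mul] at h3
  have h4 : c * A.coeff j = c * (m * l.coeff j) := by linarith
  exact ⟨_, mul_left_cancel₀ hc h4⟩

/-! ### Convergents as continuants, and the integrality criterion -/

/-- The standard recursion appends quotients at the end, while `IsContinuant.step` prepends them.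
The induction therefore carries the statement that the matrix of two consecutive convergents maps
continuants to continuants; this is needed only until termination, after which the pair stays fixed.
-/
theorem exists_contsAux_eq (g : SimpContFract ℚ⸨X⸩) (hh : g.1.h ∈ Set.range atInfinity)
    (hden : ∀ (n : ℕ) (a : ℚ⸨X⸩), g.1.partDens.get? n = some a → a ∈ Set.range atInfinity) (n : ℕ) :
    ∃ p q : ℤ[X], IsContinuant p q ∧ g.1.contsAux (n + 1) = ⟨atInfinity p, atInfinity q⟩ ∧
      (¬ g.1.TerminatedAt n → ∃ p' q' : ℤ[X],
        g.1.contsAux n = ⟨atInfinity p', atInfinity q'⟩ ∧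
        ∀ u v, IsContinuant u v → IsContinuant (p * u + p' * v) (q * u + q' * v)) := by
  induction n with
  | zero =>
    obtain ⟨a, ha⟩ := hh
    refine ⟨a, 1, by simpa using IsContinuant.base.step a, ?_, fun _ => ⟨1, 0, ?_, ?_⟩⟩
    · simp [ha]
    · simp
    · intro u v h
      simpa using h.step a
  | succ n ih =>
    obtain ⟨p, q, hpq, hc, hframe⟩ := ih
    by_cases ht : g.1.TerminatedAt n
    · refine ⟨p, q, hpq, ?_, fun h => absurd (GenContFract.terminated_stable n.le_succ ht) h⟩
      rw [GenContFract.contsAux_stable_step_of_terminated ht, hc]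
    · obtain ⟨p', q', hc', hM⟩ := hframe ht
      obtain ⟨gp, hgp⟩ := Option.ne_none_iff_exists'.1 ht
      have ha : gp.a = 1 := g.2 n gp.a (GenContFract.partNum_eq_s_a hgp)
      obtain ⟨b, hb⟩ := hden n gp.b (GenContFract.partDen_eq_s_b hgp)
      have hM' : ∀ u v, IsContinuant u v →
          IsContinuant ((p * b + p') * u + p * v) ((q * b + q') * u + q * v) := by
        intro u v h
        convert hM _ _ (h.step b) using 1 <;> ring
      refine ⟨p * b + p', q * b + q', by simpa using hM' 1 0 .base, ?_, fun _ =>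
        ⟨p, q, hc, hM'⟩⟩
      rw [GenContFract.contsAux_recurrence hgp hc' hc, ha, ← hb]
      simp [mul_comm]

open WithZero in
theorem HasSpecializableContFract.exists_isContinuant {S : ℚ⸨X⸩} (h : HasSpecializableContFract S)
    (K : ℕ) : ∃ p q : ℤ[X], IsContinuant p q ∧ q ≠ 0 ∧
      (Valued.v (atInfinity p / atInfinity q - S) : WithZero (Multiplicative ℤ)) ≤
        exp (-(K : ℤ)) := by
  obtain ⟨g, hh, hden, hne, hlim⟩ := h
  obtain ⟨n, hn, hv⟩ := (hne.and (tendsto_nhds_iff_val.1 hlim K)).exists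
  obtain ⟨p, q, hpq, hc, -⟩ := exists_contsAux_eq g hh hden n
  have hnum : g.1.nums n = atInfinity p := by
    rw [GenContFract.num_eq_conts_a, GenContFract.nth_cont_eq_succ_nth_contAux, hc]
  have hdn : g.1.dens n = atInfinity q := by
    rw [GenContFract.den_eq_conts_b, GenContFract.nth_cont_eq_succ_nth_contAux, hc]
  refine ⟨p, q, hpq, ?_, ?_⟩
  · rintro rfl
    exact hn (by rw [hdn, map_zero])
  · rwa [GenContFract.conv_eq_num_div_den, hnum, hdn] at hv

open WithZero in
/-- A necessary condition for `S` to have a specializable continued fraction, in terms of an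
approximation `P / Q` to `S`: if the matrix `(α β; γ δ)` is a product of integral elementary
matrices, then the polynomial part of its value at `S` is integral outside its constant term. -/
theorem HasSpecializableContFract.dvd_coeff {S : ℚ⸨X⸩} (hS : HasSpecializableContFract S)
    {P Q : ℤ[X]} {e : ℕ} (hQ : Q ≠ 0) (hQe : Q.natDegree < e)
    (happ : (Valued.v (S - atInfinity P / atInfinity Q) : WithZero (Multiplicative ℤ)) ≤
      exp (-(e : ℤ)))
    {α β γ δ A : ℤ[X]} {m : ℤ}
    (hM : ∀ u v, IsContinuant u v → IsContinuant (α * u + β * v) (γ * u + δ * v))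
    (hB : γ * P + δ * Q ≠ 0)
    (hγ : γ.natDegree ≤ (γ * P + δ * Q).natDegree)
    (hr : (C m * α - A * γ).natDegree ≤ (γ * P + δ * Q).natDegree + 1)
    (hC : ((C m * α - A * γ) * P + (C m * β - A * δ) * Q).natDegree ≤ (γ * P + δ * Q).natDegree)
    {j : ℕ} (hj : 0 < j) : m ∣ A.coeff j := by
  obtain ⟨u, v, huv, hv, hle⟩ := hS.exists_isContinuant e
  -- Both u/v and P/Q are within order `e` of S, so the cross difference is zero or of small degree.
  have hD : u * Q - P * v = 0 ∨ (u * Q - P * v).natDegree + e ≤ v.natDegree + Q.natDegree := by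
    by_cases h0 : u * Q - P * v = 0
    · exact Or.inl h0
    · right
      have h1 := Valuation.map_add_le _ hle happ
      rw [show atInfinity u / atInfinity v - S + (S - atInfinity P / atInfinity Q) =
        atInfinity (u * Q - P * v) / (atInfinity v * atInfinity Q) by
          have := atInfinity_ne_zero hv
          have := atInfinity_ne_zero hQ
          simp only [map_sub, map_mul]
          field_simp
          ring, map_div₀, map_mul, val_atInfinity h0, val_atInfinity hv, val_atInfinity hQ,
        ← exp_add, ← exp_sub, exp_le_exp] at h1
      omega
  set B := γ * P + δ * Q with hBdef
  have hdeg : ∀ r : ℤ[X], (r * (u * Q - P * v)).natDegree + e ≤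
      r.natDegree + v.natDegree + Q.natDegree ∨ r * (u * Q - P * v) = 0 := by
    intro r
    rcases hD with h | h
    · right; rw [h, mul_zero]
    · left
      have := natDegree_mul_le (p := r) (q := u * Q - P * v)
      omega
  have hvB : (v * B).natDegree = v.natDegree + B.natDegree := natDegree_mul hv hB
  -- The second summand has smaller degree than `v * B`, because `Q.natDegree < e`. So P/Q predicts
  -- the degree of the transformed denominator.
  have hq1 : (γ * u + δ * v) * Q = v * B + γ * (u * Q - P * v) := by rw [hBdef]; ring
  have hq2 : ((γ * u + δ * v) * Q).natDegree = v.natDegree + B.natDegree := by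
    rw [hq1]
    rcases hdeg γ with h | h
    · rw [natDegree_add_eq_left_of_natDegree_lt (by omega), hvB]
    · rw [h, add_zero, hvB]
  have hq : γ * u + δ * v ≠ 0 := by
    intro h0
    rcases hdeg γ with h | h
    · have h1 : v * B = -(γ * (u * Q - P * v)) := by rw [h0, zero_mul] at hq1; linear_combination -hq1
      have h2 : (v * B).natDegree = (γ * (u * Q - P * v)).natDegree := by rw [h1, natDegree_neg]
      omega
    · rw [h0, zero_mul, h, add_zero] at hq1
      exact mul_ne_zero hv hB hq1.symm
  refine (hM u v huv).dvd_coeff hq ?_ hj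
  rw [natDegree_mul hq hQ] at hq2
  refine (degree_le_iff_coeff_zero _ _).2 fun k hk => ?_
  by_contra hne
  rw [degree_eq_natDegree hq, Nat.cast_withBot, Nat.cast_withBot, WithBot.coe_lt_coe] at hk
  have hle1 : k ≤ (C m * (α * u + β * v) - A * (γ * u + δ * v)).natDegree :=
    le_natDegree_of_ne_zero hne
  have hne0 : C m * (α * u + β * v) - A * (γ * u + δ * v) ≠ 0 := by
    intro h; rw [h] at hne; simp at hne
  have h3 : ((C m * (α * u + β * v) - A * (γ * u + δ * v)) * Q).natDegree ≤
      v.natDegree + B.natDegree := by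
    rw [show (C m * (α * u + β * v) - A * (γ * u + δ * v)) * Q =
      v * ((C m * α - A * γ) * P + (C m * β - A * δ) * Q) +
        (C m * α - A * γ) * (u * Q - P * v) by ring]
    refine (natDegree_add_le _ _).trans (max_le ?_ ?_)
    · exact natDegree_mul_le.trans (by omega)
    · rcases hdeg (C m * α - A * γ) with h | h
      · omega
      · rw [h]; simp
  rw [natDegree_mul hne0 hQ] at h3
  omega

/-! ### Iterates, partial sums and the tail of the series -/

theorem polyIterate_zero (f : ℤ[X]) : polyIterate f 0 = X := rfl

theorem polyIterate_succ (f : ℤ[X]) (n : ℕ) : polyIterate f (n + 1) = f.comp (polyIterate f n) := by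
  simp only [polyIterate, Function.iterate_succ_apply']

theorem natDegree_polyIterate {f : ℤ[X]} (hf : f.natDegree = 2) (n : ℕ) :
    (polyIterate f n).natDegree = 2 ^ n := by
  induction n with
  | zero => simp [polyIterate_zero]
  | succ n ih => rw [polyIterate_succ, natDegree_comp, hf, ih, pow_succ, mul_comm]

theorem polyIterate_ne_zero {f : ℤ[X]} (hf : f.natDegree = 2) (n : ℕ) : polyIterate f n ≠ 0 := by
  refine ne_zero_of_natDegree_gt (n := 0) ?_
  rw [natDegree_polyIterate hf]
  positivity

open WithZero in
theorem val_iterTerm {f : ℤ[X]} (hf : f.natDegree = 2) (n : ℕ) :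
    (Valued.v (iterTerm f n) : WithZero (Multiplicative ℤ)) = exp (-(2 ^ n : ℤ)) := by
  rw [iterTerm, map_div₀, map_one, val_atInfinity (polyIterate_ne_zero hf n),
    natDegree_polyIterate hf, exp_neg, one_div]
  simp

/-- In a complete nonarchimedean group a null sequence is summable, and the n-th term has order 2ⁿ
in 1/x. -/
theorem summable_iterTerm {f : ℤ[X]} (hf : f.natDegree = 2) : Summable (iterTerm f) := by
  have : NonarchimedeanRing ℚ⸨X⸩ :=
    (Valued.v : Valuation ℚ⸨X⸩ (WithZero (Multiplicative ℤ))).subgroups_basis.nonarchimedean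
  refine NonarchimedeanAddGroup.summable_of_tendsto_cofinite_zero ?_
  rw [Nat.cofinite_eq_atTop, tendsto_nhds_iff_val]
  intro K
  filter_upwards [eventually_ge_atTop K] with n hn
  rw [sub_zero, val_iterTerm hf, WithZero.exp_le_exp]
  have : n < 2 ^ n := Nat.lt_two_pow_self
  have : (n : ℤ) < 2 ^ n := by exact_mod_cast this
  omega

-- The tail is dominated by its first term. Its order 2^N just exceeds the degree 2^N - 1 of the
-- common denominator of the partial sum, as the criterion requires.
open WithZero in
theorem val_tsum_sub_sum_range {f : ℤ[X]} (hf : f.natDegree = 2) (N : ℕ) :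
    (Valued.v ((∑' n, iterTerm f n) - ∑ n ∈ Finset.range N, iterTerm f n) :
      WithZero (Multiplicative ℤ)) ≤ exp (-(2 ^ N : ℤ)) := by
  have h := tendsto_nhds_iff_val.1 (summable_iterTerm hf).hasSum.tendsto_sum_nat (2 ^ N)
  obtain ⟨M, hM, hNM⟩ := (h.and (eventually_ge_atTop N)).exists
  have h1 : (Valued.v (∑ n ∈ Finset.Ico N M, iterTerm f n) : WithZero (Multiplicative ℤ)) ≤
      exp (-(2 ^ N : ℤ)) := by
    refine Valuation.map_sum_le _ fun i hi => ?_
    rw [val_iterTerm hf, exp_le_exp, neg_le_neg_iff]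
    exact pow_le_pow_right₀ (by norm_num) (Finset.mem_Ico.1 hi).1
  rw [Valuation.map_sub_swap] at hM
  have h2 := Valuation.map_add_le _ (by exact_mod_cast hM) h1
  rw [← Finset.sum_range_add_sum_Ico _ hNM] at h2
  convert h2 using 2
  ring

/-- Numerators of the partial sums of the series over the common denominator
`∏ polyIterate f i`. -/
def sumNum (f : ℤ[X]) : ℕ → ℤ[X]
  | 0 => 0
  | n + 1 => sumNum f n * polyIterate f n + ∏ i ∈ Finset.range n, polyIterate f i

theorem sum_iterTerm {f : ℤ[X]} (hf : f.natDegree = 2) (N : ℕ) :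
    ∑ n ∈ Finset.range N, iterTerm f n =
      atInfinity (sumNum f N) / atInfinity (∏ i ∈ Finset.range N, polyIterate f i) := by
  have hprod : ∀ N, atInfinity (∏ i ∈ Finset.range N, polyIterate f i) ≠ 0 := fun N =>
    atInfinity_ne_zero (Finset.prod_ne_zero_iff.2 fun i _ => polyIterate_ne_zero hf i)
  induction N with
  | zero => simp [sumNum]
  | succ N ih =>
    have h1 := hprod N
    have h2 := atInfinity_ne_zero (polyIterate_ne_zero hf N)
    rw [Finset.sum_range_succ, ih, Finset.prod_range_succ, sumNum, iterTerm, map_add, map_mul,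
      map_mul]
    field_simp

theorem natDegree_prod_polyIterate {f : ℤ[X]} (hf : f.natDegree = 2) (N : ℕ) :
    (∏ i ∈ Finset.range N, polyIterate f i).natDegree < 2 ^ N := by
  rw [natDegree_prod _ _ fun i _ => polyIterate_ne_zero hf i]
  simp only [natDegree_polyIterate hf]
  induction N with
  | zero => simp
  | succ N ih => rw [Finset.sum_range_succ, pow_succ]; omega

/-- The necessary condition for the series of iterates of `f`, with the partial sum of the first
`N` terms as approximation. -/
theorem HasSpecializableContFract.iterates_dvd_coeff {f : ℤ[X]} (hf : f.natDegree = 2)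
    (hS : HasSpecializableContFract (∑' n : ℕ, iterTerm f n)) (N : ℕ)
    {α β γ δ A : ℤ[X]} {m : ℤ}
    (hM : ∀ u v, IsContinuant u v → IsContinuant (α * u + β * v) (γ * u + δ * v))
    {P Q : ℤ[X]} (hP : sumNum f N = P) (hQ : ∏ i ∈ Finset.range N, polyIterate f i = Q) {d : ℕ}
    (hB : (γ * P + δ * Q).natDegree = d + 1) (hγ : γ.natDegree ≤ d + 1)
    (hr : (C m * α - A * γ).natDegree ≤ d + 2)
    (hC : ((C m * α - A * γ) * P + (C m * β - A * δ) * Q).natDegree ≤ d + 1)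
    {j : ℕ} (hj : 0 < j) : m ∣ A.coeff j := by
  have hQ0 : Q ≠ 0 := hQ ▸ Finset.prod_ne_zero_iff.2 fun i _ => polyIterate_ne_zero hf i
  refine hS.dvd_coeff (P := P) (Q := Q) (e := 2 ^ N) (δ := δ) hQ0
    (hQ ▸ natDegree_prod_polyIterate hf N) ?_ hM
    (ne_zero_of_natDegree_gt (n := 0) (by omega)) (by omega) (by omega) (by omega) hj
  have := val_tsum_sub_sum_range hf N
  rw [sum_iterTerm hf, hP, hQ] at this
  exact_mod_cast this

/-! ### Stripping partial quotients -/

/-- Remove the partial quotients in a list from a pair `(u, v)` representing `u / v`. -/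
def strip : List ℤ[X] → ℤ[X] → ℤ[X] → ℤ[X] × ℤ[X]
  | [], u, v => (u, v)
  | l :: ls, u, v => strip ls v (u - l * v)

theorem strip_eq (ls : List ℤ[X]) (u v : ℤ[X]) :
    (strip ls u v).1 = (strip ls 1 0).1 * u + (strip ls 0 1).1 * v ∧
      (strip ls u v).2 = (strip ls 1 0).2 * u + (strip ls 0 1).2 * v := by
  induction ls generalizing u v with
  | nil => simp [strip]
  | cons l ls ih =>
    simp only [strip]
    have h1 := ih v (u - l * v)
    have h2 := ih 1 (0 - l * 1)
    have h3 := ih 0 (1 - l * 0)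
    rw [h1.1, h1.2, h2.1, h2.2, h3.1, h3.2]
    constructor <;> ring

theorem IsContinuant.strip (ls : List ℤ[X]) {u v : ℤ[X]} (h : IsContinuant u v) :
    IsContinuant (strip ls u v).1 (strip ls u v).2 := by
  induction ls generalizing u v with
  | nil => exact h
  | cons l ls ih => exact ih (h.sub_mul l)

/-- If the series of iterates of `f` has a specializable continued fraction and starts with the
partial quotients in `ls` (some of which may be constant), then the polynomial part `A / m` of the
remaining complete quotient is integral outside its constant term. The conditions express that
`A / m` is this polynomial part up to a constant, and that the first `N` terms of the series
determine it. -/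
theorem HasSpecializableContFract.iterates_dvd_coeff_strip {f : ℤ[X]} (hf : f.natDegree = 2)
    (hS : HasSpecializableContFract (∑' n : ℕ, iterTerm f n)) (N : ℕ) (ls : List ℤ[X])
    {A : ℤ[X]} {m : ℤ} {P Q : ℤ[X]} (hP : sumNum f N = P)
    (hQ : ∏ i ∈ Finset.range N, polyIterate f i = Q) {d : ℕ}
    (hB : (strip ls P Q).2.natDegree = d) (hd : 0 < d) (hγ : (strip ls 1 0).2.natDegree ≤ d)
    (hr : (C m * (strip ls 1 0).1 - A * (strip ls 1 0).2).natDegree ≤ d + 1)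
    (hC : (C m * (strip ls P Q).1 - A * (strip ls P Q).2).natDegree ≤ d)
    {j : ℕ} (hj : 0 < j) : m ∣ A.coeff j := by
  obtain ⟨d, rfl⟩ : ∃ k, d = k + 1 := ⟨d - 1, by omega⟩
  obtain ⟨h1, h2⟩ := strip_eq ls P Q
  refine hS.iterates_dvd_coeff hf N (α := (strip ls 1 0).1) (β := (strip ls 0 1).1)
    (γ := (strip ls 1 0).2) (δ := (strip ls 0 1).2) (A := A) (d := d) (fun u v huv => ?_)
    hP hQ (h2 ▸ hB) hγ hr ?_ hj
  · have := huv.strip ls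
    rwa [(strip_eq ls u v).1, (strip_eq ls u v).2] at this
  · convert hC using 2
    rw [h1, h2]
    ring

/-! ### Restrictions on the coefficients of the quadratic -/

theorem polyIterate_quadratic_two (a b c : ℤ) :
    polyIterate (C a * X ^ 2 + C b * X + C c) 2 =
      C a * (C a * X ^ 2 + C b * X + C c) ^ 2 + C b * (C a * X ^ 2 + C b * X + C c) + C c := by
  simp [polyIterate_succ, polyIterate_zero]

theorem sumNum_quadratic_three (a b c : ℤ) :
    sumNum (C a * X ^ 2 + C b * X + C c) 3 = (C a * X ^ 2 + C b * X + C c + X) *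
      (C a * (C a * X ^ 2 + C b * X + C c) ^ 2 + C b * (C a * X ^ 2 + C b * X + C c) + C c) +
        X * (C a * X ^ 2 + C b * X + C c) := by
  rw [← polyIterate_quadratic_two]
  simp [sumNum, polyIterate_succ, polyIterate_zero, Finset.prod_range_succ]

theorem prod_polyIterate_quadratic_three (a b c : ℤ) :
    ∏ i ∈ Finset.range 3, polyIterate (C a * X ^ 2 + C b * X + C c) i =
      X * (C a * X ^ 2 + C b * X + C c) *
      (C a * (C a * X ^ 2 + C b * X + C c) ^ 2 + C b * (C a * X ^ 2 + C b * X + C c) + C c) := by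
  rw [← polyIterate_quadratic_two]
  simp [polyIterate_succ, polyIterate_zero, Finset.prod_range_succ]

/-- After the quotients 0, x, -a the remainder is -x/(b + 1) + O(1), so b + 1 is zero or a unit. -/
theorem linear_coeff_of_hasSpecializable {a b c : ℤ} (ha : a ≠ 0)
    (h : HasSpecializableContFract (∑' n : ℕ, iterTerm (C a * X ^ 2 + C b * X + C c) n)) :
    b = 0 ∨ b = -1 ∨ b = -2 := by
  rcases eq_or_ne b (-1) with hb | hb
  · exact Or.inr (Or.inl hb)
  obtain ⟨w, rfl⟩ : ∃ w, b = w - 1 := ⟨b + 1, by ring⟩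
  have hw : w ≠ 0 := by rintro rfl; simp at hb
  have hdvd := h.iterates_dvd_coeff_strip (natDegree_quadratic ha) 3 [0, X, -C a]
    (A := -X) (m := w) (d := 5) (j := 1)
      (sumNum_quadratic_three _ _ _) (prod_polyIterate_quadratic_three _ _ _)
    ((congrArg natDegree (by simp only [strip, eq_intCast]; push_cast; ring : _ =
      C (a^3*w) * X ^ 5 + C (a^3*c + 2*a^2*w^2 - 2*a^2*w - a^2) * X ^ 4 + C (4*a^2*c*w -
      2*a^2*c + a*w^3 - a*w^2 - a*w + 2*a) * X ^ 3 + C (2*a^2*c^2 + 3*a*c*w^2 - 3*a*c*w -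
      a*c + w^3 - 2*w^2 + 2*w - 1) * X ^ 2 + C (3*a*c^2*w - 2*a*c^2 + 2*c*w^2 - 2*c*w + 2*c)
      * X + C (a*c^3 + c^2*w))).trans
      (by compute_degree!))
    (by norm_num)
    ((congrArg natDegree (by simp only [strip, eq_intCast]; push_cast; ring : _ =
      C (-a) * X + C (1))).trans_le
      (by compute_degree!))
    ((congrArg natDegree (by simp only [strip, eq_intCast]; push_cast; ring : _ =
      C (-a) * X ^ 2 + C (-w + 1) * X)).trans_le
      (by compute_degree!))
    ((congrArg natDegree (by simp only [strip, eq_intCast]; push_cast; ring : _ =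
      C (a^3*c - a^2) * X ^ 5 + C (2*a^2*c*w - 2*a^2*c - 2*a*w + 2*a) * X ^ 4 + C (2*a^2*c^2
      + a*c*w^2 - a*c*w - a*c - w^2 + 2*w - 1) * X ^ 3 + C (2*a*c^2*w - 2*a*c^2 + c*w^2 -
      3*c*w + 2*c) * X ^ 2 + C (a*c^3 + c^2*w) * X)).trans_le
      (by compute_degree!))
    (by norm_num)
  have : IsUnit w := by
    rw [isUnit_iff_dvd_one]
    simpa using hdvd
  rcases Int.isUnit_iff.1 this with rfl | rfl <;> norm_num

/-- The remainder is ±x/(ac - 1)² + O(1) for b = 0, -2 and -ax²/(ac - 1) + O(1) for b = -1. In the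
last case ac - 1 divides a, hence ac, hence 1. -/
theorem isUnit_of_hasSpecializable {a b c : ℤ} (ha : a ≠ 0) (hac : a * c - 1 ≠ 0)
    (hb : b = 0 ∨ b = -1 ∨ b = -2)
    (h : HasSpecializableContFract (∑' n : ℕ, iterTerm (C a * X ^ 2 + C b * X + C c) n)) :
    IsUnit (a * c - 1) := by
  -- This is the leading coefficient of the stripped denominator for b = 0 and b = -2; `hac3` is the
  -- one for b = -1.
  have hac2 : -(a ^ 4 * c ^ 2) + 2 * a ^ 3 * c - a ^ 2 ≠ 0 := by
    rw [show -(a ^ 4 * c ^ 2) + 2 * a ^ 3 * c - a ^ 2 = -(a * (a * c - 1)) ^ 2 by ring]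
    simp [ha, hac]
  have hac3 : a ^ 3 * c - a ^ 2 ≠ 0 := by
    rw [show a ^ 3 * c - a ^ 2 = a ^ 2 * (a * c - 1) by ring]
    simp [ha, hac]
  rcases hb with rfl | rfl | rfl
  · have hdvd := h.iterates_dvd_coeff_strip (natDegree_quadratic ha) 3 [0, X, -C a, C c - X, -C a]
      (A := X) (m := (a * c - 1) ^ 2) (d := 4) (j := 1)
      (sumNum_quadratic_three _ _ _) (prod_polyIterate_quadratic_three _ _ _)
      ((congrArg natDegree (by simp only [strip, eq_intCast]; push_cast; ring : _ =
        C (-a^4*c^2 + 2*a^3*c - a^2) * X ^ 4 + C (a) * X ^ 3 + C (-2*a^3*c^3 + 3*a^2*c^2 -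
        a*c) * X ^ 2 + C (2*c) * X + C (-a^2*c^4 + c^2))).trans
        (by compute_degree!))
      (by norm_num)
      ((congrArg natDegree (by simp only [strip, eq_intCast]; push_cast; ring : _ =
        C (-a^2) * X ^ 2 + C (a^2*c - a) * X + C (-a*c + 1))).trans_le
        (by compute_degree!))
      ((congrArg natDegree (by simp only [strip, eq_intCast]; push_cast; ring : _ =
        C (a^2) * X ^ 3 + C (-a^3*c^2 + a^2*c) * X ^ 2 + C (a^3*c^3 - 2*a^2*c^2 + 2*a*c - 1)
        * X + C (-a^2*c^3 + 2*a*c^2 - c))).trans_le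
        (by compute_degree!))
      ((congrArg natDegree (by simp only [strip, eq_intCast]; push_cast; ring : _ =
        C (-a^5*c^4 + 3*a^4*c^3 - 3*a^3*c^2 + a^2*c - a) * X ^ 4 + C (a^2*c^2 - a*c) * X ^ 3
        + C (-2*a^4*c^5 + 5*a^3*c^4 - 4*a^2*c^3 + a*c^2 - 2*c) * X ^ 2 + C (2*a*c^3 - 2*c^2)
        * X + C (-a^3*c^6 + a^2*c^5 + a*c^4 - c^3))).trans_le
        (by compute_degree!))
      (by norm_num)
    rw [coeff_X_one] at hdvd
    exact isUnit_of_dvd_one ((dvd_pow_self _ two_ne_zero).trans hdvd)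
  · have hdvd := h.iterates_dvd_coeff_strip (natDegree_quadratic ha) 3 [0, X, -C a]
      (A := -C a * X ^ 2) (m := a * c - 1) (d := 4) (j := 2)
      (sumNum_quadratic_three _ _ _) (prod_polyIterate_quadratic_three _ _ _)
      ((congrArg natDegree (by simp only [strip, eq_intCast]; push_cast; ring : _ =
        C (a^3*c - a^2) * X ^ 4 + C (-2*a^2*c + 2*a) * X ^ 3 + C (2*a^2*c^2 - a*c - 1) * X ^
        2 + C (-2*a*c^2 + 2*c) * X + C (a*c^3))).trans
        (by compute_degree!))
      (by norm_num)
      ((congrArg natDegree (by simp only [strip, eq_intCast]; push_cast; ring : _ =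
        C (-a) * X + C (1))).trans_le
        (by compute_degree!))
      ((congrArg natDegree (by simp only [strip, eq_intCast]; push_cast; ring : _ =
        C (-a^2) * X ^ 3 + C (a) * X ^ 2 + C (-a*c + 1) * X)).trans_le
        (by compute_degree!))
      ((congrArg natDegree (by simp only [strip, eq_intCast]; push_cast; ring : _ =
        C (c) * X ^ 2)).trans_le
        (by compute_degree!))
      (by norm_num)
    have h1 : a * c - 1 ∣ a := by simpa using hdvd
    refine isUnit_of_dvd_one ?_
    have := (h1.mul_right c).sub (dvd_refl (a * c - 1))
    simpa using this
  · have hdvd := h.iterates_dvd_coeff_strip (natDegree_quadratic ha) 3 [0, X, -C a, C c + X, -C a]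
      (A := -X) (m := (a * c - 1) ^ 2) (d := 4) (j := 1)
      (sumNum_quadratic_three _ _ _) (prod_polyIterate_quadratic_three _ _ _)
      ((congrArg natDegree (by simp only [strip, eq_intCast]; push_cast; ring : _ =
        C (-a^4*c^2 + 2*a^3*c - a^2) * X ^ 4 + C (4*a^3*c^2 - 8*a^2*c + 5*a) * X ^ 3 + C
        (-2*a^3*c^3 + a^2*c^2 + 5*a*c - 6) * X ^ 2 + C (4*a^2*c^3 - 10*a*c^2 + 6*c) * X + C
        (-a^2*c^4 + 2*a*c^3 - c^2))).trans
        (by compute_degree!))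
      (by norm_num)
      ((congrArg natDegree (by simp only [strip, eq_intCast]; push_cast; ring : _ =
        C (a^2) * X ^ 2 + C (a^2*c - 3*a) * X + C (-a*c + 1))).trans_le
        (by compute_degree!))
      ((congrArg natDegree (by simp only [strip, eq_intCast]; push_cast; ring : _ =
        C (a^2) * X ^ 3 + C (a^3*c^2 - a^2*c - 2*a) * X ^ 2 + C (a^3*c^3 - 4*a^2*c^2 + 4*a*c
        - 1) * X + C (-a^2*c^3 + 2*a*c^2 - c))).trans_le
        (by compute_degree!))
      ((congrArg natDegree (by simp only [strip, eq_intCast]; push_cast; ring : _ =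
        C (-a^5*c^4 + 3*a^4*c^3 - 3*a^3*c^2 + a^2*c + a) * X ^ 4 + C (4*a^4*c^4 - 12*a^3*c^3
        + 13*a^2*c^2 - 5*a*c - 2) * X ^ 3 + C (-2*a^4*c^5 + 3*a^3*c^4 + 4*a^2*c^3 - 11*a*c^2
        + 6*c) * X ^ 2 + C (4*a^3*c^5 - 14*a^2*c^4 + 16*a*c^3 - 6*c^2) * X + C (-a^3*c^6 +
        3*a^2*c^5 - 3*a*c^4 + c^3))).trans_le
        (by compute_degree!))
      (by norm_num)
    have h1 : (a * c - 1) ^ 2 ∣ 1 := by simpa using hdvd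
    exact isUnit_of_dvd_one ((dvd_pow_self _ two_ne_zero).trans h1)

/-- Here ac - 1 = -1 gives no obstruction, but two quotients further the three-term partial sum
leaves the remainder x/3 up to a constant. -/
theorem not_hasSpecializable_neg_two_zero {a : ℤ} (ha : a ≠ 0) :
    ¬ HasSpecializableContFract (∑' n : ℕ, iterTerm (C a * X ^ 2 + C (-2) * X + C 0) n) := by
  intro h
  have hdvd := h.iterates_dvd_coeff_strip (natDegree_quadratic ha) 3 [0, X, -C a, X, -C a, -X, -C a]
    (A := X) (m := (3 : ℤ)) (d := 3) (j := 1)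
      (sumNum_quadratic_three _ _ _) (prod_polyIterate_quadratic_three _ _ _)
    ((congrArg natDegree (by simp only [strip, eq_intCast]; push_cast; ring : _ =
      C (3*a) * X ^ 3 + C (-6) * X ^ 2)).trans
      (by compute_degree!))
    (by norm_num)
    ((congrArg natDegree (by simp only [strip, eq_intCast]; push_cast; ring : _ =
      C (a^3) * X ^ 3 + C (-a^2) * X ^ 2 + C (-4*a) * X + C (1))).trans_le
      (by compute_degree!))
    ((congrArg natDegree (by simp only [strip, eq_intCast]; push_cast; ring : _ =
      C (-a^3) * X ^ 4 + C (4*a^2) * X ^ 3 + C (-2*a) * X ^ 2 + C (-4) * X)).trans_le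
      (by compute_degree!))
    ((congrArg natDegree (by simp only [strip, eq_intCast]; push_cast; ring : _ =
      (0 : ℤ[X]))).trans_le
      (by simp))
    (by norm_num)
  rw [coeff_X_one] at hdvd
  norm_num at hdvd

/-! ### Exclusion of the sporadic polynomials with ac = 1 or ac = 2 -/

theorem coeff_ofNat_of_pos (n k : ℕ) [n.AtLeastTwo] (hk : 0 < k) :
    (OfNat.ofNat n : ℤ[X]).coeff k = 0 := by
  obtain ⟨k, rfl⟩ : ∃ l, k = l + 1 := ⟨k - 1, by omega⟩
  exact coeff_ofNat_succ n k

theorem iterates_zero (f : ℤ[X]) :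
    sumNum f 0 = 0 ∧ ∏ i ∈ Finset.range 0, polyIterate f i = 1 ∧ polyIterate f 0 = X := by
  simp [sumNum, polyIterate_zero]

theorem iterates_succ {a b c : ℤ} {n : ℕ} {P Q F : ℤ[X]}
    (h : sumNum (C a * X ^ 2 + C b * X + C c) n = P ∧
      ∏ i ∈ Finset.range n, polyIterate (C a * X ^ 2 + C b * X + C c) i = Q ∧
      polyIterate (C a * X ^ 2 + C b * X + C c) n = F) :
    sumNum (C a * X ^ 2 + C b * X + C c) (n + 1) = P * F + Q ∧
      ∏ i ∈ Finset.range (n + 1), polyIterate (C a * X ^ 2 + C b * X + C c) i = Q * F ∧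
      polyIterate (C a * X ^ 2 + C b * X + C c) (n + 1) = C a * F ^ 2 + C b * F + C c := by
  obtain ⟨rfl, rfl, rfl⟩ := h
  rw [sumNum, Finset.prod_range_succ, polyIterate_succ]
  simp

set_option maxHeartbeats 4000000 in
theorem not_hasSpecializable_one_neg_two_two {e : ℤ} (he : e = 1 ∨ e = -1) :
    ¬ HasSpecializableContFract (∑' n : ℕ,
      iterTerm (C (e) * X ^ 2 + C (-2) * X + C (2 * e)) n) := by
  intro h
  have it := iterates_succ (iterates_succ (iterates_succ (iterates_zero (C (e) * X ^ 2 + C (-2) * X + C (2 * e)))))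
  refine absurd (h.iterates_dvd_coeff_strip
    (natDegree_quadratic (by rcases he with rfl | rfl <;> norm_num)) 3
    [0, X - C e, -X, -X] (A := -X)
    (m := (3 : ℤ)) (d := 3) (j := 1) it.1 it.2.1 ?_ (by norm_num) ?_ ?_ ?_ (by norm_num))
    (by norm_num [coeff_X_one])
  all_goals
    rcases he with rfl | rfl
    all_goals
      simp only [strip, eq_intCast]
      push_cast
      ring_nf
      compute_degree!
  all_goals rw [coeff_ofNat_of_pos] <;> norm_num

set_option maxHeartbeats 4000000 in
theorem not_hasSpecializable_two_neg_two_one {e : ℤ} (he : e = 1 ∨ e = -1) :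
    ¬ HasSpecializableContFract (∑' n : ℕ,
      iterTerm (C (2 * e) * X ^ 2 + C (-2) * X + C (e)) n) := by
  intro h
  have it := iterates_succ (iterates_succ (iterates_succ (iterates_zero (C (2 * e) * X ^ 2 + C (-2) * X + C (e)))))
  refine absurd (h.iterates_dvd_coeff_strip
    (natDegree_quadratic (by rcases he with rfl | rfl <;> norm_num)) 3
    [0, X - C e, C (2 * e), X - C e, C (2 * e), -X - C e, C (2 * e)] (A := X)
    (m := (3 : ℤ)) (d := 3) (j := 1) it.1 it.2.1 ?_ (by norm_num) ?_ ?_ ?_ (by norm_num))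
    (by norm_num [coeff_X_one])
  all_goals
    rcases he with rfl | rfl
    all_goals
      simp only [strip, eq_intCast]
      push_cast
      ring_nf
      compute_degree!

set_option maxHeartbeats 4000000 in
theorem not_hasSpecializable_one_zero_two {e : ℤ} (he : e = 1 ∨ e = -1) :
    ¬ HasSpecializableContFract (∑' n : ℕ,
      iterTerm (C (e) * X ^ 2 + C (0) * X + C (2 * e)) n) := by
  intro h
  have it := iterates_succ (iterates_succ (iterates_succ (iterates_succ (iterates_zero (C (e) * X ^ 2 + C (0) * X + C (2 * e))))))
  refine absurd (h.iterates_dvd_coeff_strip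
    (natDegree_quadratic (by rcases he with rfl | rfl <;> norm_num)) 4
    [0, X - C e, X, X + C (2 * e), X + C (2 * e)] (A := X)
    (m := (9 : ℤ)) (d := 10) (j := 1) it.1 it.2.1 ?_ (by norm_num) ?_ ?_ ?_ (by norm_num))
    (by norm_num [coeff_X_one])
  all_goals
    rcases he with rfl | rfl
    all_goals
      simp only [strip, eq_intCast]
      push_cast
      ring_nf
      compute_degree!
  all_goals rw [coeff_ofNat_of_pos] <;> norm_num

set_option maxHeartbeats 4000000 in
theorem not_hasSpecializable_two_zero_one {e : ℤ} (he : e = 1 ∨ e = -1) :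
    ¬ HasSpecializableContFract (∑' n : ℕ,
      iterTerm (C (2 * e) * X ^ 2 + C (0) * X + C (e)) n) := by
  intro h
  have it := iterates_succ (iterates_succ (iterates_succ (iterates_succ (iterates_zero (C (2 * e) * X ^ 2 + C (0) * X + C (e))))))
  refine absurd (h.iterates_dvd_coeff_strip
    (natDegree_quadratic (by rcases he with rfl | rfl <;> norm_num)) 4
    [0, X - C e, C (2 * e), -X - C e, C (2 * e), X, C (2 * e), -X - C (2 * e), C (2 * e)] (A := X)
    (m := (9 : ℤ)) (d := 10) (j := 1) it.1 it.2.1 ?_ (by norm_num) ?_ ?_ ?_ (by norm_num))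
    (by norm_num [coeff_X_one])
  all_goals
    rcases he with rfl | rfl
    all_goals
      simp only [strip, eq_intCast]
      push_cast
      ring_nf
      compute_degree!
  all_goals rw [coeff_ofNat_of_pos] <;> norm_num

set_option maxHeartbeats 4000000 in
theorem not_hasSpecializable_one_neg_one_two {e : ℤ} (he : e = 1 ∨ e = -1) :
    ¬ HasSpecializableContFract (∑' n : ℕ,
      iterTerm (C (e) * X ^ 2 + C (-1) * X + C (2 * e)) n) := by
  intro h
  have it := iterates_succ (iterates_succ (iterates_succ (iterates_succ (iterates_zero (C (e) * X ^ 2 + C (-1) * X + C (2 * e))))))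
  refine absurd (h.iterates_dvd_coeff_strip
    (natDegree_quadratic (by rcases he with rfl | rfl <;> norm_num)) 4
    [0, X - C e, C e * X ^ 2 + C e, -C e * X ^ 2 + 2 * X - C (5 * e)] (A := X)
    (m := (4 : ℤ)) (d := 9) (j := 1) it.1 it.2.1 ?_ (by norm_num) ?_ ?_ ?_ (by norm_num))
    (by norm_num [coeff_X_one])
  all_goals
    rcases he with rfl | rfl
    all_goals
      simp only [strip, eq_intCast]
      push_cast
      ring_nf
      compute_degree!

set_option maxHeartbeats 4000000 in
theorem not_hasSpecializable_two_neg_one_one {e : ℤ} (he : e = 1 ∨ e = -1) :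
    ¬ HasSpecializableContFract (∑' n : ℕ,
      iterTerm (C (2 * e) * X ^ 2 + C (-1) * X + C (e)) n) := by
  intro h
  have it := iterates_succ (iterates_succ (iterates_succ (iterates_succ (iterates_zero (C (2 * e) * X ^ 2 + C (-1) * X + C (e))))))
  refine absurd (h.iterates_dvd_coeff_strip
    (natDegree_quadratic (by rcases he with rfl | rfl <;> norm_num)) 4
    [0, X - C e, C (2 * e), -C (2 * e) * X ^ 2 - C e, C (8 * e) * X ^ 2 - 8 * X + C (10 * e)] (A := -X)
    (m := (4 : ℤ)) (d := 9) (j := 1) it.1 it.2.1 ?_ (by norm_num) ?_ ?_ ?_ (by norm_num))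
    (by norm_num [coeff_X_one])
  all_goals
    rcases he with rfl | rfl
    all_goals
      simp only [strip, eq_intCast]
      push_cast
      ring_nf
      compute_degree!
  all_goals rw [coeff_ofNat_of_pos] <;> norm_num

-- For ±(x² + 1) the previous obstructions are absent since ac - 1 = 0; a denominator 9 appears only
-- after seven quotients, and five terms of the series are used to see it.
set_option maxHeartbeats 4000000 in
theorem not_hasSpecializable_one_zero_one {e : ℤ} (he : e = 1 ∨ e = -1) :
    ¬ HasSpecializableContFract (∑' n : ℕ,
      iterTerm (C (e) * X ^ 2 + C (0) * X + C (e)) n) := by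
  intro h
  have it := iterates_succ (iterates_succ (iterates_succ (iterates_succ (iterates_succ (iterates_zero (C (e) * X ^ 2 + C (0) * X + C (e)))))))
  refine absurd (h.iterates_dvd_coeff_strip
    (natDegree_quadratic (by rcases he with rfl | rfl <;> norm_num)) 5
    [0, X - C e, X + C e, -C e * X ^ 2 - C (2 * e), -X, -C e * X ^ 2 - C (2 * e), X + C (3 * e)] (A := X)
    (m := (9 : ℤ)) (d := 22) (j := 1) it.1 it.2.1 ?_ (by norm_num) ?_ ?_ ?_ (by norm_num))
    (by norm_num [coeff_X_one])
  all_goals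
    rcases he with rfl | rfl
    all_goals
      simp only [strip, eq_intCast]
      push_cast
      ring_nf
      compute_degree!
  all_goals rw [coeff_ofNat_of_pos] <;> norm_num

/-- Either ac = 1, or ac - 1 = ±1 so that ac is 2 or 0. With b ∈ {0, -1, -2} this leaves the listed
polynomials and those excluded one by one. -/
theorem eq_of_hasSpecializable {f : ℤ[X]} (hf : f.natDegree = 2)
    (h : HasSpecializableContFract (∑' n : ℕ, iterTerm f n)) :
    (∃ k : ℤ, f = C k * X ^ 2) ∨ (∃ k : ℤ, f = C k * X ^ 2 - X) ∨
      f = X ^ 2 - X + 1 ∨ f = X ^ 2 - 2 * X + 1 ∨ f = -X ^ 2 - X - 1 ∨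
      f = -X ^ 2 - 2 * X - 1 := by
  obtain ⟨a, ha, b, c, rfl⟩ : ∃ a : ℤ, a ≠ 0 ∧ ∃ b c : ℤ, f = C a * X ^ 2 + C b * X + C c := by
    refine ⟨f.coeff 2, ?_, f.coeff 1, f.coeff 0,
      eq_quadratic_of_degree_le_two (natDegree_le_iff_degree_le.1 hf.le)⟩
    rw [← hf]
    exact leadingCoeff_ne_zero.2 (ne_zero_of_natDegree_gt (n := 0) (by omega))
  have hb := linear_coeff_of_hasSpecializable ha h
  by_cases hac : a * c = 1
  · have : (a = 1 ∨ a = -1) ∧ c = a := by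
      have h1 : a = 1 ∨ a = -1 := Int.isUnit_iff.1 (IsUnit.of_mul_eq_one _ hac)
      refine ⟨h1, ?_⟩
      rcases h1 with rfl | rfl <;> omega
    obtain ⟨h1, rfl⟩ := this
    rcases hb with rfl | rfl | rfl
    · exact absurd h (not_hasSpecializable_one_zero_one h1)
    · rcases h1 with rfl | rfl
      · right; right; left; simp; ring
      · right; right; right; right; left; simp; ring
    · rcases h1 with rfl | rfl
      · right; right; right; left; simp; ring
      · right; right; right; right; right; simp; ring
  · rcases Int.isUnit_iff.1 (isUnit_of_hasSpecializable ha (sub_ne_zero.2 hac) hb h) with h2 | h2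
    · have h3 : ∃ e : ℤ, (e = 1 ∨ e = -1) ∧ ((a = e ∧ c = 2 * e) ∨ (a = 2 * e ∧ c = e)) := by
        have hac2 : a * c = 2 := by omega
        have hle : a.natAbs ≤ 2 := Nat.le_of_dvd two_pos
          (by simpa using Int.natAbs_dvd_natAbs.2 (Dvd.intro _ hac2))
        have h4 : -2 ≤ a ∧ a ≤ 2 := by omega
        obtain ⟨h5, h6⟩ := h4
        interval_cases a
        · exact ⟨-1, Or.inr rfl, Or.inr ⟨rfl, by omega⟩⟩
        · exact ⟨-1, Or.inr rfl, Or.inl ⟨rfl, by omega⟩⟩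
        · exact absurd rfl ha
        · exact ⟨1, Or.inl rfl, Or.inl ⟨rfl, by omega⟩⟩
        · exact ⟨1, Or.inl rfl, Or.inr ⟨rfl, by omega⟩⟩
      obtain ⟨e, he, ⟨rfl, rfl⟩ | ⟨rfl, rfl⟩⟩ := h3
      · rcases hb with rfl | rfl | rfl
        · exact absurd h (not_hasSpecializable_one_zero_two he)
        · exact absurd h (not_hasSpecializable_one_neg_one_two he)
        · exact absurd h (not_hasSpecializable_one_neg_two_two he)
      · rcases hb with rfl | rfl | rfl
        · exact absurd h (not_hasSpecializable_two_zero_one he)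
        · exact absurd h (not_hasSpecializable_two_neg_one_one he)
        · exact absurd h (not_hasSpecializable_two_neg_two_one he)
    · have hc : c = 0 := by
        have : a * c = 0 := by omega
        exact (mul_eq_zero.1 this).resolve_left ha
      subst hc
      rcases hb with rfl | rfl | rfl
      · exact Or.inl ⟨a, by simp⟩
      · exact Or.inr (Or.inl ⟨a, by simp; ring⟩)
      · exact absurd h (not_hasSpecializable_neg_two_zero ha)

/-! ### Matrices of words of partial quotients -/

/-- The matrix of one step `a + 1 / ·` of a continued fraction. -/
def quotientMat (a : ℤ[X]) : Matrix (Fin 2) (Fin 2) ℤ[X] := !![a, 1; 1, 0]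

/-- The product of the matrices of the steps of a continued fraction. -/
def wordMat (w : List ℤ[X]) : Matrix (Fin 2) (Fin 2) ℤ[X] := (w.map quotientMat).prod

theorem wordMat_append (v w : List ℤ[X]) : wordMat (v ++ w) = wordMat v * wordMat w := by
  simp [wordMat]

/-- Lists of partial quotients, none of them zero, of which no two neighbours are constant, and
neither the first nor the last is. -/
structure IsRegularWord (w : List ℤ[X]) : Prop where
  ne_nil : w ≠ []
  ne_zero : ∀ a ∈ w, a ≠ 0
  chain : w.IsChain fun a b => 0 < a.natDegree ∨ 0 < b.natDegree
  head : ∀ a ∈ w.head?, 0 < a.natDegree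
  last : ∀ a ∈ w.getLast?, 0 < a.natDegree

theorem IsRegularWord.singleton {a : ℤ[X]} (ha : 0 < a.natDegree) : IsRegularWord [a] where
  ne_nil := by simp
  ne_zero := by
    rintro b hb rfl
    simp at hb
    simp [← hb] at ha
  chain := by simp
  head := by simpa using ha
  last := by simpa using ha

theorem IsRegularWord.append {v w : List ℤ[X]} (hv : IsRegularWord v) (hw : IsRegularWord w) :
    IsRegularWord (v ++ w) where
  ne_nil := by simp [hv.ne_nil]
  ne_zero := by
    intro a ha
    rcases List.mem_append.1 ha with h | h
    exacts [hv.ne_zero a h, hw.ne_zero a h]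
  chain := List.isChain_append.2 ⟨hv.chain, hw.chain, fun a ha _ _ => Or.inl (hv.last a ha)⟩
  head := by
    rw [List.head?_append_of_ne_nil _ hv.ne_nil]
    exact hv.head
  last := by
    rw [List.getLast?_append_of_ne_nil _ hw.ne_nil]
    exact hw.last

theorem IsRegularWord.append_cons {v w : List ℤ[X]} {c : ℤ[X]} (hv : IsRegularWord v) (hc : c ≠ 0)
    (hw : IsRegularWord w) : IsRegularWord (v ++ c :: w) where
  ne_nil := by simp
  ne_zero := by
    intro a ha
    rcases List.mem_append.1 ha with h | h
    · exact hv.ne_zero a h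
    · rcases List.mem_cons.1 h with rfl | h
      exacts [hc, hw.ne_zero a h]
  chain := List.isChain_append.2 ⟨hv.chain,
    List.isChain_cons.2 ⟨fun b hb => Or.inr (hw.head b hb), hw.chain⟩,
    fun a ha _ _ => Or.inl (hv.last a ha)⟩
  head := by
    rw [List.head?_append_of_ne_nil _ hv.ne_nil]
    exact hv.head
  last := by
    rw [List.getLast?_append_of_ne_nil _ (by simp), List.getLast?_cons_of_ne_nil hw.ne_nil]
    exact hw.last

/-- Matrices of regular words, up to sign. -/
inductive IsRegularMat : Matrix (Fin 2) (Fin 2) ℤ[X] → Prop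
  | quotient {a : ℤ[X]} (ha : 0 < a.natDegree) : IsRegularMat (quotientMat a)
  | mul {A B : Matrix (Fin 2) (Fin 2) ℤ[X]} (hA : IsRegularMat A) (hB : IsRegularMat B) :
      IsRegularMat (A * B)
  | mul_quotient_mul {A B : Matrix (Fin 2) (Fin 2) ℤ[X]} {c : ℤ[X]} (hA : IsRegularMat A)
      (hc : c ≠ 0) (hB : IsRegularMat B) : IsRegularMat (A * quotientMat c * B)
  | neg {A : Matrix (Fin 2) (Fin 2) ℤ[X]} (hA : IsRegularMat A) : IsRegularMat (-A)

/-- Quotient matrices are symmetric, so transposition reverses the word, and regularity is symmetric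
under reversal. -/
theorem IsRegularMat.transpose {A : Matrix (Fin 2) (Fin 2) ℤ[X]} (hA : IsRegularMat A) :
    IsRegularMat A.transpose := by
  have hT : ∀ a, (quotientMat a).transpose = quotientMat a := by
    intro a
    ext i j
    fin_cases i <;> fin_cases j <;> rfl
  induction hA with
  | quotient ha => rw [hT]; exact .quotient ha
  | mul _ _ hA hB => rw [Matrix.transpose_mul]; exact hB.mul hA
  | mul_quotient_mul _ hc _ hA hB =>
    rw [Matrix.transpose_mul, Matrix.transpose_mul, hT, ← mul_assoc]
    exact hB.mul_quotient_mul hc hA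
  | neg _ hA => rw [Matrix.transpose_neg]; exact hA.neg

/-- The matrix obtained by changing the signs of the off-diagonal entries. -/
def signConj (A : Matrix (Fin 2) (Fin 2) ℤ[X]) : Matrix (Fin 2) (Fin 2) ℤ[X] :=
  !![A 0 0, -A 0 1; -A 1 0, A 1 1]

theorem signConj_mul (A B : Matrix (Fin 2) (Fin 2) ℤ[X]) :
    signConj (A * B) = signConj A * signConj B := by
  ext i j
  fin_cases i <;> fin_cases j <;> simp [signConj, Matrix.mul_apply] <;> ring

theorem signConj_neg (A : Matrix (Fin 2) (Fin 2) ℤ[X]) : signConj (-A) = -signConj A := by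
  ext i j
  fin_cases i <;> fin_cases j <;> simp [signConj]

/-- Thus `signConj` negates every letter of a word, up to an overall sign of the matrix. -/
theorem signConj_quotientMat (a : ℤ[X]) : signConj (quotientMat a) = -quotientMat (-a) := by
  ext i j
  fin_cases i <;> fin_cases j <;> simp [signConj, quotientMat]

theorem IsRegularMat.signConj {A : Matrix (Fin 2) (Fin 2) ℤ[X]} (hA : IsRegularMat A) :
    IsRegularMat (signConj A) := by
  induction hA with
  | quotient ha =>
    rw [signConj_quotientMat]
    exact (IsRegularMat.quotient (by rwa [natDegree_neg])).neg
  | mul _ _ hA hB => rw [signConj_mul]; exact hA.mul hB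
  | @mul_quotient_mul A B c _ hc _ hA hB =>
    rw [signConj_mul, signConj_mul, signConj_quotientMat, mul_neg, neg_mul]
    exact (hA.mul_quotient_mul (neg_ne_zero.2 hc) hB).neg
  | neg _ hA => rw [signConj_neg]; exact hA.neg

theorem IsRegularMat.exists_word {A : Matrix (Fin 2) (Fin 2) ℤ[X]} (hA : IsRegularMat A) :
    ∃ w, IsRegularWord w ∧ (A = wordMat w ∨ A = -wordMat w) := by
  induction hA with
  | @quotient a ha => exact ⟨[a], .singleton ha, Or.inl (by simp [wordMat])⟩
  | mul _ _ hA hB =>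
    obtain ⟨v, hv, rfl | rfl⟩ := hA <;> obtain ⟨w, hw, rfl | rfl⟩ := hB <;>
      exact ⟨v ++ w, hv.append hw, by simp [wordMat_append]⟩
  | @mul_quotient_mul _ _ c _ hc _ hA hB =>
    have h : ∀ v w, wordMat (v ++ c :: w) = wordMat v * quotientMat c * wordMat w := by
      simp [wordMat, mul_assoc]
    obtain ⟨v, hv, rfl | rfl⟩ := hA <;> obtain ⟨w, hw, rfl | rfl⟩ := hB <;>
      exact ⟨v ++ c :: w, hv.append_cons hc hw, by simp [h]⟩
  | neg _ hA =>
    obtain ⟨v, hv, rfl | rfl⟩ := hA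
    · exact ⟨v, hv, Or.inr rfl⟩
    · exact ⟨v, hv, Or.inl (neg_neg _)⟩

/-! ### Infinite continued fractions from regular words -/

/-- The continued fraction `[0, a 0, a 1, …]`. -/
def contFractOf (a : ℕ → ℤ[X]) : SimpContFract ℚ⸨X⸩ :=
  ⟨⟨0, ⟨fun n => some ⟨1, atInfinity (a n)⟩, by intro n h; simp at h⟩⟩, by
    intro n b hb
    simp [GenContFract.partNums, Stream'.Seq.map, Stream'.Seq.get?, Stream'.map,
      Stream'.get] at hb
    exact hb.symm⟩

theorem contFractOf_get? (a : ℕ → ℤ[X]) (n : ℕ) :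
    (contFractOf a).1.s.get? n = some ⟨1, atInfinity (a n)⟩ := rfl

theorem wordMat_range_succ (a : ℕ → ℤ[X]) (n : ℕ) :
    wordMat ((List.range (n + 1)).map a) =
      wordMat ((List.range n).map a) * quotientMat (a n) := by
  rw [List.range_succ, List.map_append, wordMat_append]
  simp [wordMat]

theorem contsAux_contFractOf (a : ℕ → ℤ[X]) (n : ℕ) :
    (contFractOf a).1.contsAux n =
        ⟨atInfinity (wordMat ((List.range n).map a) 1 1),
          atInfinity (wordMat ((List.range n).map a) 0 1)⟩ ∧
      (contFractOf a).1.contsAux (n + 1) =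
        ⟨atInfinity (wordMat ((List.range n).map a) 1 0),
          atInfinity (wordMat ((List.range n).map a) 0 0)⟩ := by
  induction n with
  | zero => simp [wordMat, contFractOf]
  | succ n ih =>
    rw [wordMat_range_succ]
    refine ⟨?_, ?_⟩
    · rw [ih.2]
      simp [quotientMat, Matrix.mul_apply]
    · rw [GenContFract.contsAux_recurrence (contFractOf_get? a n) ih.1 ih.2]
      simp [quotientMat, Matrix.mul_apply, mul_comm]

theorem det_quotientMat (a : ℤ[X]) : (quotientMat a).det = -1 := by
  simp [quotientMat, Matrix.det_fin_two]

theorem det_wordMat (w : List ℤ[X]) : (wordMat w).det = 1 ∨ (wordMat w).det = -1 := by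
  induction w with
  | nil => simp [wordMat]
  | cons a w ih =>
    have : wordMat (a :: w) = quotientMat a * wordMat w := by simp [wordMat]
    rw [this, Matrix.det_mul, det_quotientMat]
    rcases ih with h | h <;> simp [h]

theorem atInfinity_neg_div_neg (p q : ℤ[X]) :
    atInfinity (-p) / atInfinity (-q) = atInfinity p / atInfinity q := by
  rw [neg_eq_neg_one_mul p, neg_eq_neg_one_mul q, map_mul, map_mul, mul_div_mul_left]
  exact atInfinity_ne_zero (by simp)

theorem atInfinity_neg_div (p q : ℤ[X]) :
    atInfinity (-p) / atInfinity q = -(atInfinity p / atInfinity q) := by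
  refine eq_neg_of_add_eq_zero_left ?_
  rw [← add_div, ← map_add, neg_add_cancel, map_zero, zero_div]

/-- Degrees of denominators add as in the classical case. A constant quotient does no harm because
it follows a non-constant one, so the previous denominator already has strictly smaller degree; this
alternative is carried through the induction. -/
theorem wordMat_range_degree {a : ℕ → ℤ[X]} (h0 : ∀ n, a n ≠ 0)
    (hc : ∀ n, 0 < (a n).natDegree ∨ 0 < (a (n + 1)).natDegree) (n : ℕ) :
    (wordMat ((List.range n).map a) 0 0 ≠ 0 ∧
      (wordMat ((List.range n).map a) 0 1).degree ≤ (wordMat ((List.range n).map a) 0 0).degree ∧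
      ((wordMat ((List.range n).map a) 0 1).degree < (wordMat ((List.range n).map a) 0 0).degree ∨
        0 < (a n).natDegree)) ∧
    (wordMat ((List.range (n + 1)).map a) 0 0).natDegree =
      (wordMat ((List.range n).map a) 0 0).natDegree + (a n).natDegree := by
  have key : ∀ n, (wordMat ((List.range n).map a) 0 0 ≠ 0 ∧
      (wordMat ((List.range n).map a) 0 1).degree ≤ (wordMat ((List.range n).map a) 0 0).degree ∧
      ((wordMat ((List.range n).map a) 0 1).degree < (wordMat ((List.range n).map a) 0 0).degree ∨
        0 < (a n).natDegree)) →
      (wordMat ((List.range (n + 1)).map a) 0 0).degree =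
        (wordMat ((List.range n).map a) 0 0 * a n).degree := by
    rintro n ⟨hq, hle, hlt⟩
    rw [wordMat_range_succ]
    simp only [quotientMat, Matrix.mul_apply, Fin.sum_univ_two, Matrix.of_apply, Matrix.cons_val',
      Matrix.cons_val_zero, Matrix.cons_val_one, Matrix.cons_val_fin_one, mul_one]
    rw [degree_add_eq_left_of_degree_lt]
    rw [degree_mul]
    rcases hlt with h | h
    · refine h.trans_le ?_
      rw [degree_eq_natDegree (h0 n), degree_eq_natDegree hq]
      norm_cast
      omega
    · refine hle.trans_lt ?_
      rw [degree_eq_natDegree (h0 n), degree_eq_natDegree hq]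
      norm_cast
      omega
  have hI : ∀ n, (wordMat ((List.range n).map a) 0 0 ≠ 0 ∧
      (wordMat ((List.range n).map a) 0 1).degree ≤ (wordMat ((List.range n).map a) 0 0).degree ∧
      ((wordMat ((List.range n).map a) 0 1).degree < (wordMat ((List.range n).map a) 0 0).degree ∨
        0 < (a n).natDegree)) := by
    intro n
    induction n with
    | zero => simp [wordMat]
    | succ n ih =>
      have h1 := key n ih
      have h2 : wordMat ((List.range (n + 1)).map a) 0 1 = wordMat ((List.range n).map a) 0 0 := by
        rw [wordMat_range_succ]
        simp [quotientMat, Matrix.mul_apply]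
      have hne := mul_ne_zero ih.1 (h0 n)
      have h3 : (wordMat ((List.range n).map a) 0 0 * a n).natDegree =
        (wordMat ((List.range n).map a) 0 0).natDegree + (a n).natDegree :=
          natDegree_mul ih.1 (h0 n)
      rw [h2, h1, ← degree_ne_bot, h1, degree_ne_bot, degree_eq_natDegree hne,
        degree_eq_natDegree ih.1]
      refine ⟨hne, by norm_cast; omega, ?_⟩
      rcases hc n with h | h
      · left
        norm_cast
        omega
      · exact Or.inr h
  refine ⟨hI n, ?_⟩
  rw [natDegree_eq_of_degree_eq (key n (hI n)), natDegree_mul (hI n).1 (h0 n)]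

-- Of two consecutive quotients one is non-constant, so the denominators grow, the convergents form
-- a Cauchy sequence, and a limit along a subsequence is the limit.
open WithZero in
theorem hasSpecializable_of_quotients {a : ℕ → ℤ[X]} (h0 : ∀ n, a n ≠ 0)
    (hc : ∀ n, 0 < (a n).natDegree ∨ 0 < (a (n + 1)).natDegree)
    {S : ℚ⸨X⸩} {φ : ℕ → ℕ} (hφ : Tendsto φ atTop atTop)
    (hlim : Tendsto (fun n => atInfinity (wordMat ((List.range (φ n)).map a) 1 0) /
      atInfinity (wordMat ((List.range (φ n)).map a) 0 0)) atTop (𝓝 S)) :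
    HasSpecializableContFract S := by
  set W : ℕ → Matrix (Fin 2) (Fin 2) ℤ[X] := fun n => wordMat ((List.range n).map a) with hW
  have hq : ∀ n, W n 0 0 ≠ 0 := fun n => (wordMat_range_degree h0 hc n).1.1
  have hdeg : ∀ n, (W (n + 1) 0 0).natDegree = (W n 0 0).natDegree + (a n).natDegree :=
    fun n => (wordMat_range_degree h0 hc n).2
  have hgrow : ∀ n, n ≤ (W n 0 0).natDegree + (W (n + 1) 0 0).natDegree := by
    intro n
    induction n with
    | zero => exact Nat.zero_le _
    | succ n ih =>
      have := hdeg n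
      have := hdeg (n + 1)
      rcases hc n with h | h <;> omega
  have hden : ∀ n, (contFractOf a).1.dens n = atInfinity (W n 0 0) := by
    intro n
    rw [GenContFract.den_eq_conts_b, GenContFract.nth_cont_eq_succ_nth_contAux,
      (contsAux_contFractOf a n).2]
  have hnum : ∀ n, (contFractOf a).1.nums n = atInfinity (W n 1 0) := by
    intro n
    rw [GenContFract.num_eq_conts_a, GenContFract.nth_cont_eq_succ_nth_contAux,
      (contsAux_contFractOf a n).2]
  have hconv : ∀ n, (contFractOf a).1.convs n = atInfinity (W n 1 0) / atInfinity (W n 0 0) := by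
    intro n
    rw [GenContFract.conv_eq_num_div_den, hnum, hden]
  have hstep : ∀ n, (Valued.v ((contFractOf a).1.convs (n + 1) - (contFractOf a).1.convs n) :
      WithZero (Multiplicative ℤ)) ≤ exp (-(n : ℤ)) := by
    intro n
    have h1 : W (n + 1) 0 1 = W n 0 0 ∧ W (n + 1) 1 1 = W n 1 0 := by
      simp only [hW, wordMat_range_succ]
      simp [quotientMat, Matrix.mul_apply]
    have h2 := det_wordMat ((List.range (n + 1)).map a)
    rw [Matrix.det_fin_two] at h2
    change W (n + 1) 0 0 * W (n + 1) 1 1 - W (n + 1) 0 1 * W (n + 1) 1 0 = 1 ∨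
      W (n + 1) 0 0 * W (n + 1) 1 1 - W (n + 1) 0 1 * W (n + 1) 1 0 = -1 at h2
    rw [h1.1, h1.2] at h2
    have hD : W (n + 1) 1 0 * W n 0 0 - W n 1 0 * W (n + 1) 0 0 ≠ 0 ∧
        (W (n + 1) 1 0 * W n 0 0 - W n 1 0 * W (n + 1) 0 0).natDegree = 0 := by
      rcases h2 with h | h
      · rw [show W (n + 1) 1 0 * W n 0 0 - W n 1 0 * W (n + 1) 0 0 = -1 by linear_combination -h]
        simp
      · rw [show W (n + 1) 1 0 * W n 0 0 - W n 1 0 * W (n + 1) 0 0 = 1 by linear_combination -h]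
        simp
    have e1 := atInfinity_ne_zero (hq n)
    have e2 := atInfinity_ne_zero (hq (n + 1))
    rw [hconv, hconv, show atInfinity (W (n + 1) 1 0) / atInfinity (W (n + 1) 0 0) -
        atInfinity (W n 1 0) / atInfinity (W n 0 0) =
        atInfinity (W (n + 1) 1 0 * W n 0 0 - W n 1 0 * W (n + 1) 0 0) /
        (atInfinity (W n 0 0) * atInfinity (W (n + 1) 0 0)) by
          simp only [map_sub, map_mul]
          field_simp, map_div₀, map_mul, val_atInfinity hD.1, val_atInfinity (hq n),
        val_atInfinity (hq (n + 1)), ← exp_add, ← exp_sub, exp_le_exp, hD.2]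
    have := hgrow n
    push_cast
    omega
  have hcauchy : ∀ n m, n ≤ m →
      (Valued.v ((contFractOf a).1.convs m - (contFractOf a).1.convs n) :
        WithZero (Multiplicative ℤ)) ≤ exp (-(n : ℤ)) := by
    intro n m h
    induction m, h using Nat.le_induction with
    | base => simp
    | succ m h ih =>
      rw [← sub_add_sub_cancel _ ((contFractOf a).1.convs m)]
      refine Valuation.map_add_le _ ((hstep m).trans ?_) ih
      rw [exp_le_exp]
      omega
  refine ⟨contFractOf a, ⟨0, by simp [contFractOf]⟩, ?_, ?_, ?_⟩
  · intro n b hb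
    obtain ⟨gp, hgp, rfl⟩ := GenContFract.exists_s_b_of_partDen hb
    rw [contFractOf_get?] at hgp
    obtain rfl := Option.some.inj hgp
    exact ⟨a n, rfl⟩
  · exact Eventually.of_forall fun n => by
      rw [hden]
      exact atInfinity_ne_zero (hq n)
  · rw [tendsto_nhds_iff_val] at hlim ⊢
    intro K
    refine eventually_atTop.2 ⟨K, fun m hm => ?_⟩
    obtain ⟨k, hk1, hk2⟩ := ((hlim K).and (hφ.eventually_ge_atTop m)).exists
    rw [← hconv] at hk1
    rw [show (contFractOf a).1.convs m - S = -((contFractOf a).1.convs (φ k) -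
      (contFractOf a).1.convs m) + ((contFractOf a).1.convs (φ k) - S) by ring]
    refine Valuation.map_add_le _ ?_ hk1
    rw [Valuation.map_neg]
    refine (hcauchy m _ hk2).trans ?_
    rw [exp_le_exp]
    omega

/-- A sequence of regular matrices, each obtained by extending the word of the previous one. -/
structure IsRegularSeq (M : ℕ → Matrix (Fin 2) (Fin 2) ℤ[X]) : Prop where
  zero : IsRegularMat (M 0)
  succ (n : ℕ) : ∃ B, IsRegularMat B ∧
    (M (n + 1) = M n * B ∨ ∃ c, c ≠ 0 ∧ M (n + 1) = M n * quotientMat c * B)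

theorem IsRegularSeq.exists_words {M : ℕ → Matrix (Fin 2) (Fin 2) ℤ[X]} (hM : IsRegularSeq M) :
    ∃ w : ℕ → List ℤ[X], (∀ n, IsRegularWord (w n) ∧ (M n = wordMat (w n) ∨ M n = -wordMat (w n))) ∧
      ∀ n, w n <+: w (n + 1) ∧ (w n).length < (w (n + 1)).length := by
  have hstep : ∀ n, ∀ v : {v // IsRegularWord v ∧ (M n = wordMat v ∨ M n = -wordMat v)},
      ∃ v' : {v // IsRegularWord v ∧ (M (n + 1) = wordMat v ∨ M (n + 1) = -wordMat v)},
        v.1 <+: v'.1 ∧ v.1.length < v'.1.length := by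
    rintro n ⟨v, hv, hMv⟩
    obtain ⟨B, hB, h⟩ := hM.succ n
    obtain ⟨u, hu, hBu⟩ := hB.exists_word
    rcases h with h | ⟨c, hc, h⟩
    · refine ⟨⟨v ++ u, hv.append hu, ?_⟩, List.prefix_append _ _, ?_⟩
      · rw [h, wordMat_append]
        rcases hMv with h1 | h1 <;> rcases hBu with h2 | h2 <;> simp [h1, h2]
      · simpa using List.length_pos_of_ne_nil hu.ne_nil
    · refine ⟨⟨v ++ c :: u, hv.append_cons hc hu, ?_⟩, List.prefix_append _ _, by simp⟩
      have h3 : wordMat (v ++ c :: u) = wordMat v * quotientMat c * wordMat u := by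
        simp [wordMat, mul_assoc]
      rw [h, h3]
      rcases hMv with h1 | h1 <;> rcases hBu with h2 | h2 <;> simp [h1, h2]
  choose f hf using hstep
  obtain ⟨w₀, hw₀⟩ := hM.zero.exists_word
  exact ⟨fun n => (Nat.rec (motive := fun n =>
    {v // IsRegularWord v ∧ (M n = wordMat v ∨ M n = -wordMat v)}) ⟨w₀, hw₀⟩ f n).1,
    fun n => Subtype.property (Nat.rec (motive := fun n =>
      {v // IsRegularWord v ∧ (M n = wordMat v ∨ M n = -wordMat v)}) ⟨w₀, hw₀⟩ f n),
    fun n => hf n _⟩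

theorem IsRegularSeq.hasSpecializable {M : ℕ → Matrix (Fin 2) (Fin 2) ℤ[X]} (hM : IsRegularSeq M)
    {S : ℚ⸨X⸩} (hlim : Tendsto (fun n => atInfinity (M n 1 0) / atInfinity (M n 0 0)) atTop (𝓝 S)) :
    HasSpecializableContFract S := by
  obtain ⟨w, hw, hpre⟩ := hM.exists_words
  have hmono : ∀ m n, m ≤ n → w m <+: w n := by
    intro m n h
    induction n, h using Nat.le_induction with
    | base => exact List.prefix_rfl
    | succ n h ih => exact ih.trans (hpre n).1
  have hlen : ∀ n, n < (w n).length := by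
    intro n
    induction n with
    | zero => exact List.length_pos_of_ne_nil (hw 0).1.ne_nil
    | succ n ih => exact lt_of_le_of_lt ih (hpre n).2
  -- Each word is a prefix of the next, and the n-th word has more than n letters, so the diagonal
  -- reads off the common infinite word.
  set a : ℕ → ℤ[X] := fun n => (w n)[n]'(hlen n) with ha
  have hget : ∀ k n (h : n < (w k).length), (w k)[n] = a n := by
    intro k n h
    rcases le_total k n with hk | hk
    · exact (hmono k n hk).getElem h
    · exact ((hmono n k hk).getElem (hlen n)).symm
  have hwa : ∀ k, (List.range (w k).length).map a = w k := by
    intro k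
    refine List.ext_getElem (by simp) fun n h1 h2 => ?_
    rw [hget k n h2]
    simp
  refine hasSpecializable_of_quotients (a := a) (φ := fun n => (w n).length) ?_ ?_ ?_ ?_
  · exact fun n => (hw n).1.ne_zero _ (List.getElem_mem _)
  · intro n
    have := List.isChain_iff_getElem.1 (hw (n + 1)).1.chain n (hlen (n + 1))
    rwa [hget, hget] at this
  · exact tendsto_atTop_mono (fun n => (hlen n).le) tendsto_id
  · refine hlim.congr fun n => ?_
    rw [hwa]
    rcases (hw n).2 with h | h
    · rw [h]
    · rw [h, Matrix.neg_apply, Matrix.neg_apply, atInfinity_neg_div_neg]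

theorem IsRegularSeq.hasSpecializable_neg {M : ℕ → Matrix (Fin 2) (Fin 2) ℤ[X]}
    (hM : IsRegularSeq M) {S : ℚ⸨X⸩}
    (hlim : Tendsto (fun n => atInfinity (M n 1 0) / atInfinity (M n 0 0)) atTop (𝓝 S)) :
    HasSpecializableContFract (-S) := by
  have h : IsRegularSeq fun n => signConj (M n) := by
    refine ⟨hM.zero.signConj, fun n => ?_⟩
    obtain ⟨B, hB, h | ⟨c, hc, h⟩⟩ := hM.succ n
    · exact ⟨signConj B, hB.signConj, Or.inl (by rw [h, signConj_mul])⟩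
    · refine ⟨-signConj B, hB.signConj.neg, Or.inr ⟨-c, neg_ne_zero.2 hc, ?_⟩⟩
      rw [h, signConj_mul, signConj_mul, signConj_quotientMat]
      simp
  refine h.hasSpecializable (hlim.neg.congr fun n => ?_)
  exact (atInfinity_neg_div _ _).symm

/-! ### The family kx²: folding -/

theorem atInfinity_div_eq_add {p q p' q' d r : ℤ[X]} (hq : q ≠ 0) (hq' : q' ≠ 0) (hr : r ≠ 0)
    (h : (p' * q - p * q') * r = d * (q * q')) :
    atInfinity p' / atInfinity q' =
      atInfinity p / atInfinity q + atInfinity d / atInfinity r := by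
  have h1 := congrArg atInfinity h
  simp only [map_mul, map_sub] at h1
  have := atInfinity_ne_zero hq
  have := atInfinity_ne_zero hq'
  have := atInfinity_ne_zero hr
  field_simp
  linear_combination h1

theorem det_signConj_transpose (A : Matrix (Fin 2) (Fin 2) ℤ[X]) :
    (signConj A.transpose).det = A.det := by
  simp [signConj, Matrix.det_fin_two]
  ring

/-- Matrices of the partial sums of `∑ 1 / fⁿ` for `f = k x²`, by the folding lemma. -/
def foldMat (k : ℤ) : ℕ → Matrix (Fin 2) (Fin 2) ℤ[X]
  | 0 => quotientMat X
  | n + 1 => foldMat k n * quotientMat (C (-k)) * signConj (foldMat k n).transpose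

theorem isRegularMat_foldMat {k : ℤ} (hk : k ≠ 0) (n : ℕ) : IsRegularMat (foldMat k n) := by
  induction n with
  | zero => exact .quotient (by simp)
  | succ n ih => exact ih.mul_quotient_mul (by simpa using hk) ih.transpose.signConj

theorem det_foldMat (k : ℤ) (n : ℕ) : (foldMat k n).det = -1 := by
  induction n with
  | zero => exact det_quotientMat X
  | succ n ih =>
    rw [foldMat, Matrix.det_mul, Matrix.det_mul, det_signConj_transpose, ih, det_quotientMat]
    ring

/-- With p/q the old value, the new one is p/q + 1/(kq²). -/
theorem foldMat_succ_apply (k : ℤ) (n : ℕ) :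
    foldMat k (n + 1) 0 0 = -(C k * foldMat k n 0 0 ^ 2) ∧
      foldMat k (n + 1) 1 0 = -(C k * foldMat k n 0 0 * foldMat k n 1 0) - 1 := by
  have h := det_foldMat k n
  rw [Matrix.det_fin_two] at h
  constructor
  · simp [foldMat, quotientMat, signConj, Matrix.mul_apply]
    ring
  · simp [foldMat, quotientMat, signConj, Matrix.mul_apply]
    linear_combination h

theorem iterTerm_eq (f : ℤ[X]) (n : ℕ) :
    iterTerm f n = atInfinity 1 / atInfinity (polyIterate f n) := by
  rw [map_one]; rfl

theorem hasSpecializable_sq {k : ℤ} (hf : (C k * X ^ 2 : ℤ[X]).natDegree = 2) :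
    HasSpecializableContFract (∑' n, iterTerm (C k * X ^ 2) n) := by
  have hk : k ≠ 0 := by rintro rfl; simp at hf
  set f : ℤ[X] := C k * X ^ 2 with hfdef
  have hseq : IsRegularSeq (foldMat k) := ⟨isRegularMat_foldMat hk 0, fun n =>
    ⟨_, (isRegularMat_foldMat hk n).transpose.signConj, Or.inr ⟨C (-k), by simpa using hk, rfl⟩⟩⟩
  -- The denominator agrees with the iterate only up to sign; the folding step involves its square
  -- alone.
  have hsq : ∀ n, foldMat k n 0 0 ^ 2 = polyIterate f n ^ 2 := by
    intro n
    induction n with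
    | zero => simp [foldMat, quotientMat, polyIterate_zero]
    | succ n ih =>
      rw [(foldMat_succ_apply k n).1, ih, polyIterate_succ, hfdef]
      simp
  have hne : ∀ n, foldMat k n 0 0 ≠ 0 := by
    intro n h
    have := hsq n
    rw [h, zero_pow two_ne_zero] at this
    exact polyIterate_ne_zero hf n (pow_eq_zero_iff two_ne_zero |>.1 this.symm)
  have hsum : ∀ n, ∑ i ∈ Finset.range (n + 1), iterTerm f i =
      atInfinity (foldMat k n 1 0) / atInfinity (foldMat k n 0 0) := by
    intro n
    induction n with
    | zero => simp [iterTerm_eq, polyIterate_zero, foldMat, quotientMat]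
    | succ n ih =>
      rw [Finset.sum_range_succ, ih, iterTerm_eq]
      refine (atInfinity_div_eq_add (hne n) (hne _) (polyIterate_ne_zero hf _) ?_).symm
      have h1 := hsq n
      rw [(foldMat_succ_apply k n).1, (foldMat_succ_apply k n).2, polyIterate_succ, hfdef]
      simp only [mul_comp, C_comp, pow_comp, X_comp]
      linear_combination C k * foldMat k n 0 0 * h1
  refine hseq.hasSpecializable ?_
  refine ((summable_iterTerm hf).hasSum.tendsto_sum_nat.comp (tendsto_add_atTop_nat 1)).congr ?_
  exact fun n => hsum n

/-! ### The family kx² - x: one quotient per term -/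

/-- Matrices of the partial sums of `∑ 1 / fⁿ` for `f = k x² - x`. -/
def sylvesterMat (k : ℤ) : ℕ → Matrix (Fin 2) (Fin 2) ℤ[X]
  | 0 => quotientMat X
  | n + 1 => sylvesterMat k n *
      quotientMat (C k * (sylvesterMat k n).det * sylvesterMat k n 0 1 ^ 2)

theorem det_sylvesterMat (k : ℤ) (n : ℕ) :
    (sylvesterMat k n).det = 1 ∨ (sylvesterMat k n).det = -1 := by
  induction n with
  | zero => exact Or.inr (det_quotientMat X)
  | succ n ih =>
    rw [sylvesterMat, Matrix.det_mul, det_quotientMat]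
    rcases ih with h | h <;> simp [h]

theorem sylvesterMat_succ_apply (k : ℤ) (n : ℕ) :
    sylvesterMat k (n + 1) 0 0 = C k * (sylvesterMat k n).det * sylvesterMat k n 0 1 ^ 2 *
      sylvesterMat k n 0 0 + sylvesterMat k n 0 1 ∧
    sylvesterMat k (n + 1) 1 0 = C k * (sylvesterMat k n).det * sylvesterMat k n 0 1 ^ 2 *
      sylvesterMat k n 1 0 + sylvesterMat k n 1 1 ∧
    sylvesterMat k (n + 1) 0 1 = sylvesterMat k n 0 0 ∧
    (sylvesterMat k (n + 1)).det = -(sylvesterMat k n).det := by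
  refine ⟨?_, ?_, ?_, ?_⟩
  · rw [sylvesterMat]
    simp [quotientMat, Matrix.mul_apply, mul_comm]
  · rw [sylvesterMat]
    simp [quotientMat, Matrix.mul_apply, mul_comm]
  · rw [sylvesterMat]
    simp [quotientMat, Matrix.mul_apply]
  · rw [sylvesterMat, Matrix.det_mul, det_quotientMat]
    ring

theorem hasSpecializable_sq_sub {k : ℤ} (hf : (C k * X ^ 2 - X : ℤ[X]).natDegree = 2) :
    HasSpecializableContFract (∑' n, iterTerm (C k * X ^ 2 - X) n) := by
  have hk : k ≠ 0 := by rintro rfl; simp at hf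
  set f : ℤ[X] := C k * X ^ 2 - X with hfdef
  set M := sylvesterMat k with hM
  have hdd : ∀ n, (M n).det * (M n).det = 1 := by
    intro n
    rcases det_sylvesterMat k n with h | h <;> rw [hM, h] <;> ring
  have hiter : ∀ n, polyIterate f (n + 1) = C k * polyIterate f n ^ 2 - polyIterate f n := by
    intro n
    rw [polyIterate_succ]
    nth_rewrite 1 [hfdef]
    simp
  -- This is what makes the construction work: consecutive convergents differ by ±1 over the product
  -- of their denominators, so the next step adds exactly 1/fⁿ⁺¹.
  have hprod : ∀ n, M n 0 0 * M n 0 1 = -(M n).det * polyIterate f n := by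
    intro n
    induction n with
    | zero => simp [hM, sylvesterMat, det_quotientMat, polyIterate_zero]; simp [quotientMat]
    | succ n ih =>
      obtain ⟨h1, h2, h3, h4⟩ := sylvesterMat_succ_apply k n
      rw [← hM] at h1 h2 h3 h4
      rw [h1, h3, h4, hiter]
      linear_combination (C k * (M n).det * (M n 0 0 * M n 0 1 - (M n).det * polyIterate f n) +
        1) * ih + (C k * (M n).det * polyIterate f n ^ 2) * hdd n
  have hne : ∀ n, M n 0 0 ≠ 0 ∧ M n 0 1 ≠ 0 := by
    intro n
    have h : M n 0 0 * M n 0 1 ≠ 0 := by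
      rw [hprod]
      refine mul_ne_zero ?_ (polyIterate_ne_zero hf n)
      rcases det_sylvesterMat k n with h | h <;> rw [hM, h] <;> simp
    exact ⟨left_ne_zero_of_mul h, right_ne_zero_of_mul h⟩
  have hdeg : ∀ n, (M n 0 0).natDegree + (M n 0 1).natDegree = 2 ^ n := by
    intro n
    rw [← natDegree_mul (hne n).1 (hne n).2, hprod, ← natDegree_polyIterate hf]
    rcases det_sylvesterMat k n with h | h <;> rw [hM, h] <;> simp
  have hpos : ∀ n, 0 < (M n 0 0).natDegree := by
    intro n
    cases n with
    | zero => simp [hM, sylvesterMat, quotientMat]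
    | succ n =>
      have h1 := hdeg n
      have h2 := hdeg (n + 1)
      rw [hM, (sylvesterMat_succ_apply k n).2.2.1, ← hM] at h2
      have h3 : 2 ^ (n + 1) = 2 * 2 ^ n := pow_succ' 2 n
      have h4 : 0 < 2 ^ n := by positivity
      omega
  have hletter : ∀ n, 0 < (C k * (M (n + 1)).det * M (n + 1) 0 1 ^ 2).natDegree := by
    intro n
    have h1 : (M (n + 1) 0 1 ^ 2).natDegree = 2 * (M n 0 0).natDegree := by
      rw [natDegree_pow, hM, (sylvesterMat_succ_apply k n).2.2.1]
    have h2 := hpos n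
    rcases det_sylvesterMat k (n + 1) with h | h
    · rw [hM, h, mul_one, natDegree_C_mul hk, ← hM, h1]
      omega
    · rw [hM, h, mul_neg_one, ← C_neg, natDegree_C_mul (neg_ne_zero.2 hk), ← hM, h1]
      omega
  have hsucc : ∀ n, M (n + 1) = M n * quotientMat (C k * (M n).det * M n 0 1 ^ 2) := fun n => rfl
  -- The second quotient is the constant -k, so the word of `M 1` ends in a constant and is not
  -- regular; the sequence starts at `M 2`.
  have hseq : IsRegularSeq fun n => M (n + 2) := by
    refine ⟨?_, fun n => ⟨_, .quotient (hletter (n + 1)), Or.inl (hsucc _)⟩⟩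
    have h0 : M 0 = quotientMat X := rfl
    change IsRegularMat (M (1 + 1))
    rw [hsucc 1, hsucc 0]
    nth_rewrite 1 [h0]
    refine (IsRegularMat.quotient (by simp)).mul_quotient_mul ?_ (.quotient (hletter 0))
    rw [h0, det_quotientMat]
    simpa [quotientMat] using hk
  have hsum : ∀ n, ∑ i ∈ Finset.range (n + 1), iterTerm f i =
      atInfinity (M n 1 0) / atInfinity (M n 0 0) := by
    intro n
    induction n with
    | zero => simp [iterTerm_eq, polyIterate_zero, hM, sylvesterMat, quotientMat]
    | succ n ih =>
      rw [Finset.sum_range_succ, ih, iterTerm_eq]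
      refine (atInfinity_div_eq_add (hne n).1 (hne _).1 (polyIterate_ne_zero hf _) ?_).symm
      have h0 := hprod (n + 1)
      obtain ⟨h1, h2, h3, h4⟩ := sylvesterMat_succ_apply k n
      rw [← hM] at h1 h2 h3 h4
      rw [h3, h4] at h0
      have h5 := Matrix.det_fin_two (M n)
      rw [h2]
      linear_combination (-1) * h0 + polyIterate f (n + 1) * (-h5 - M n 1 0 * h1)
  refine hseq.hasSpecializable ?_
  refine ((summable_iterTerm hf).hasSum.tendsto_sum_nat.comp (tendsto_add_atTop_nat 3)).congr ?_
  exact fun n => hsum (n + 2)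

/-! ### The polynomials ±(x² + 1) - x: a telescoping sum -/

open WithZero in
theorem tendsto_sum_iterTerm_add {f : ℤ[X]} (hf : f.natDegree = 2) {e : ℕ → ℚ⸨X⸩}
    (he : ∀ n, (Valued.v (e n) : WithZero (Multiplicative ℤ)) ≤ exp (-(n : ℤ))) :
    Tendsto (fun n => ∑ i ∈ Finset.range n, iterTerm f i + e n) atTop
      (𝓝 (∑' n, iterTerm f n)) := by
  have h : Tendsto e atTop (𝓝 0) := by
    rw [tendsto_nhds_iff_val]
    intro K
    refine eventually_atTop.2 ⟨K, fun n hn => ?_⟩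
    rw [sub_zero]
    refine (he n).trans ?_
    rw [exp_le_exp]
    omega
  simpa using (summable_iterTerm hf).hasSum.tendsto_sum_nat.add h

theorem hasSpecializable_one_div {p : ℤ[X]} (hp : p ≠ 0) :
    HasSpecializableContFract (1 / atInfinity p) := by
  let s : Stream'.Seq (GenContFract.Pair ℚ⸨X⸩) :=
    ⟨fun n => if n = 0 then some ⟨1, atInfinity p⟩ else none, by
      intro n hn
      simp⟩
  let g : SimpContFract ℚ⸨X⸩ := ⟨⟨0, s⟩, by
    intro n b hb
    obtain ⟨gp, hgp, rfl⟩ := GenContFract.exists_s_a_of_partNum hb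
    have h : (if n = 0 then some (⟨1, atInfinity p⟩ : GenContFract.Pair ℚ⸨X⸩) else none) =
      some gp := hgp
    split_ifs at h
    rw [← Option.some.inj h]⟩
  have hg0 : g.1.s.get? 0 = some ⟨1, atInfinity p⟩ := rfl
  have ht : g.1.TerminatedAt 1 := rfl
  have h1 : g.1.dens 1 = atInfinity p := by
    rw [GenContFract.first_den_eq hg0]
  have h2 : g.1.nums 1 = 1 := by
    rw [GenContFract.first_num_eq hg0]
    simp [g]
  refine ⟨g, ⟨0, by simp [g]⟩, ?_, ?_, ?_⟩
  · intro n b hb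
    obtain ⟨gp, hgp, rfl⟩ := GenContFract.exists_s_b_of_partDen hb
    have h : (if n = 0 then some (⟨1, atInfinity p⟩ : GenContFract.Pair ℚ⸨X⸩) else none) =
      some gp := hgp
    split_ifs at h
    rw [← Option.some.inj h]
    exact ⟨p, rfl⟩
  · refine eventually_atTop.2 ⟨1, fun n hn => ?_⟩
    rw [GenContFract.dens_stable_of_terminated hn ht, h1]
    exact atInfinity_ne_zero hp
  · refine tendsto_const_nhds.congr' (eventually_atTop.2 ⟨1, fun n hn => ?_⟩)
    change 1 / atInfinity p = g.1.convs n
    rw [GenContFract.convs_stable_of_terminated hn ht, GenContFract.conv_eq_num_div_den, h1, h2]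

-- From f(y) - e = ey(y - e) one gets 1/y = 1/(y - e) - 1/(f(y) - e), so the whole series is 1/(x -
-- e).
open WithZero in
theorem hasSpecializable_sq_sub_add {e : ℤ} (he : e * e = 1)
    (hf : (C e * X ^ 2 - X + C e : ℤ[X]).natDegree = 2) :
    HasSpecializableContFract (∑' n, iterTerm (C e * X ^ 2 - X + C e) n) := by
  set f : ℤ[X] := C e * X ^ 2 - X + C e with hfdef
  have hC : (C e * C e : ℤ[X]) = 1 := by rw [← C_mul, he, C_1]
  have hdeg : ∀ n, (polyIterate f n - C e).natDegree = 2 ^ n := by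
    intro n
    rw [natDegree_sub_C, natDegree_polyIterate hf]
  have hne : ∀ n, polyIterate f n - C e ≠ 0 := by
    intro n h
    have h1 := hdeg n
    rw [h, natDegree_zero] at h1
    exact (pow_pos two_pos n).ne h1
  have hiter : ∀ n, polyIterate f (n + 1) =
      C e * polyIterate f n ^ 2 - polyIterate f n + C e := by
    intro n
    rw [polyIterate_succ]
    nth_rewrite 1 [hfdef]
    simp
  have hsum : ∀ n, ∑ i ∈ Finset.range n, iterTerm f i + 1 / atInfinity (polyIterate f n - C e) =
      1 / atInfinity (polyIterate f 0 - C e) := by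
    intro n
    induction n with
    | zero => simp
    | succ n ih =>
      rw [← ih, Finset.sum_range_succ, add_assoc, iterTerm_eq]
      congr 1
      have h := atInfinity_div_eq_add (p := 1) (q := polyIterate f (n + 1) - C e) (p' := 1)
        (q' := polyIterate f n - C e) (d := 1) (r := polyIterate f n) (hne _) (hne _)
        (polyIterate_ne_zero hf n) (by
          rw [hiter]
          linear_combination polyIterate f n ^ 2 * hC)
      rw [map_one] at h ⊢
      rw [h, add_comm]
  have hS : ∑' n, iterTerm f n = 1 / atInfinity (polyIterate f 0 - C e) := by
    refine tendsto_nhds_unique (tendsto_sum_iterTerm_add hf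
      (e := fun n => 1 / atInfinity (polyIterate f n - C e)) fun n => ?_) ?_
    · rw [map_div₀, map_one, val_atInfinity (hne n), hdeg, one_div, ← exp_neg, exp_le_exp,
        neg_le_neg_iff]
      exact_mod_cast n.lt_two_pow_self.le
    · simp only [hsum]
      exact tendsto_const_nhds
  rw [hS]
  exact hasSpecializable_one_div (hne 0)

/-! ### The polynomials e(x - e)²: mirrored words -/

/-- The iterates of `y ↦ (y - 1)²` at `u`. -/
def shiftSq (u : ℤ[X]) : ℕ → ℤ[X]
  | 0 => u
  | n + 1 => (shiftSq u n - 1) ^ 2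

theorem shiftSq_zero (u : ℤ[X]) : shiftSq u 0 = u := rfl

theorem shiftSq_succ (u : ℤ[X]) (n : ℕ) : shiftSq u (n + 1) = (shiftSq u n - 1) ^ 2 := rfl

/-- The matrix of the word `-w, t, wᵣ`, where `wᵣ` is the reversal of the word `w` of `A`. -/
def mirrorMat (A : Matrix (Fin 2) (Fin 2) ℤ[X]) (t : ℤ[X]) : Matrix (Fin 2) (Fin 2) ℤ[X] :=
  signConj A * quotientMat t * A.transpose

theorem mirrorMat_apply {A : Matrix (Fin 2) (Fin 2) ℤ[X]} (hA : A.det = 1) (t : ℤ[X]) :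
    mirrorMat A t 0 0 = t * A 0 0 ^ 2 ∧ mirrorMat A t 0 1 = 1 + t * A 0 0 * A 1 0 ∧
      mirrorMat A t 1 0 = 1 - t * A 0 0 * A 1 0 ∧ (mirrorMat A t).det = -1 := by
  have h := hA
  rw [Matrix.det_fin_two] at h
  refine ⟨?_, ?_, ?_, ?_⟩
  · simp [mirrorMat, signConj, quotientMat, Matrix.mul_apply]
    ring
  · simp [mirrorMat, signConj, quotientMat, Matrix.mul_apply]
    linear_combination h
  · simp [mirrorMat, signConj, quotientMat, Matrix.mul_apply]
    linear_combination h
  · have h1 : (signConj A).det = A.det := by simp [signConj, Matrix.det_fin_two]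
    rw [mirrorMat, Matrix.det_mul, Matrix.det_mul, h1, Matrix.det_transpose, det_quotientMat, hA]
    ring

/-- Matrices of the continued fractions that approximate `∑ 1 / yₙ` for `yₙ₊₁ = (yₙ - 1)²`. -/
def shiftMat (u : ℤ[X]) : ℕ → Matrix (Fin 2) (Fin 2) ℤ[X]
  | 0 => quotientMat (u - 1) * quotientMat (1 - u) * quotientMat ((u - 1) ^ 2 - 1) * quotientMat u
  | 1 => quotientMat (u - 1) * quotientMat (1 - u) * quotientMat ((u - 1) ^ 2 - 1) * quotientMat u *
      quotientMat ((shiftSq u 0 - 2) ^ 2) *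
      (quotientMat (1 - u) * quotientMat (-u) * quotientMat (u - 1))
  | 2 => quotientMat (u - 1) * quotientMat (1 - u) * quotientMat ((u - 1) ^ 2 - 1) * quotientMat u *
      quotientMat ((shiftSq u 0 - 2) ^ 2) *
      (quotientMat (1 - u) * quotientMat (-u) * quotientMat (u - 1)) *
      quotientMat ((shiftSq u 1 - 2) ^ 2) *
      (quotientMat (1 - u) * quotientMat (u - 1) * quotientMat ((u - 1) ^ 2) * quotientMat (1 - u) *
        quotientMat (u - 1))
  | k + 3 => shiftMat u (k + 2) * quotientMat ((shiftSq u (k + 2) - 2) ^ 2) *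
      mirrorMat (shiftMat u k) ((shiftSq u k - 2) ^ 2)

/-- The last factor in the recursion for `shiftMat`. -/
def shiftTail (u : ℤ[X]) : ℕ → Matrix (Fin 2) (Fin 2) ℤ[X]
  | 0 => quotientMat (1 - u) * quotientMat (-u) * quotientMat (u - 1)
  | 1 => quotientMat (1 - u) * quotientMat (u - 1) * quotientMat ((u - 1) ^ 2) *
      quotientMat (1 - u) * quotientMat (u - 1)
  | k + 2 => mirrorMat (shiftMat u k) ((shiftSq u k - 2) ^ 2)

theorem shiftMat_succ (u : ℤ[X]) (k : ℕ) : shiftMat u (k + 1) =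
    shiftMat u k * quotientMat ((shiftSq u k - 2) ^ 2) * shiftTail u k := by
  match k with
  | 0 => rfl
  | 1 => rfl
  | k + 2 => rfl

theorem det_shiftMat (u : ℤ[X]) (k : ℕ) : (shiftMat u k).det = 1 := by
  induction k using Nat.strong_induction_on with
  | _ k ih =>
    match k with
    | 0 => simp [shiftMat, det_quotientMat]
    | 1 => simp [shiftMat, det_quotientMat]
    | 2 => simp [shiftMat, det_quotientMat]
    | k + 3 =>
      rw [shiftMat, Matrix.det_mul, Matrix.det_mul, ih (k + 2) (by omega), det_quotientMat,
        (mirrorMat_apply (ih k (by omega)) _).2.2.2]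
      ring

theorem det_shiftTail (u : ℤ[X]) (k : ℕ) : (shiftTail u k).det = -1 := by
  match k with
  | 0 => simp [shiftTail, det_quotientMat]
  | 1 => simp [shiftTail, det_quotientMat]
  | k + 2 => exact (mirrorMat_apply (det_shiftMat u k) _).2.2.2

theorem shiftMat_succ_apply (u : ℤ[X]) (k : ℕ) :
    (shiftMat u (k + 1) 0 0 = shiftMat u k 0 0 * ((shiftSq u k - 2) ^ 2 * shiftTail u k 0 0 +
        shiftTail u k 1 0) + shiftMat u k 0 1 * shiftTail u k 0 0) ∧
      shiftTail u k 0 0 * shiftMat u (k + 1) 0 1 =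
        shiftTail u k 0 1 * shiftMat u (k + 1) 0 0 - shiftMat u k 0 0 ∧
      shiftMat u (k + 1) 1 0 * shiftMat u k 0 0 - shiftMat u k 1 0 * shiftMat u (k + 1) 0 0 =
        shiftTail u k 0 0 := by
  have h1 := det_shiftMat u k
  have h2 := det_shiftTail u k
  rw [Matrix.det_fin_two] at h1 h2
  rw [shiftMat_succ]
  generalize shiftMat u k = W at *
  generalize shiftTail u k = N at *
  refine ⟨?_, ?_, ?_⟩
  · simp [quotientMat, Matrix.mul_apply]
    ring
  · simp [quotientMat, Matrix.mul_apply]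
    linear_combination W 0 0 * h2
  · simp [quotientMat, Matrix.mul_apply]
    linear_combination N 0 0 * h1

theorem shiftMat_zero_apply (u : ℤ[X]) : shiftMat u 0 0 0 = -(u * (((u - 1) ^ 2 - 1) ^ 2 - 1)) ∧
    shiftMat u 0 1 0 = 1 + (u - 1) + (u - 1) ^ 2 - (u - 1) ^ 3 - (u - 1) ^ 4 := by
  constructor
  · simp [shiftMat, quotientMat, Matrix.mul_apply]
    ring
  · simp [shiftMat, quotientMat, Matrix.mul_apply]
    ring

/-- For a mirrored tail the entry is tq² with t = (y - 2)² and q = -y(yₖ₊₂ - 1), where y = yₖ; it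
equals yₖ₊₂yₖ₊₃ because (y(y - 2))² = yₖ₊₂. -/
theorem shiftTail_apply (u : ℤ[X]) (k : ℕ)
    (h : ∀ j < k, shiftMat u j 0 0 = -(shiftSq u j * (shiftSq u (j + 2) - 1))) :
    shiftTail u k 0 0 = shiftSq u k * shiftSq u (k + 1) := by
  match k with
  | 0 =>
    simp [shiftTail, quotientMat, Matrix.mul_apply, shiftSq]
    ring
  | 1 =>
    simp [shiftTail, quotientMat, Matrix.mul_apply, shiftSq]
    ring
  | k + 2 =>
    rw [shiftTail, (mirrorMat_apply (det_shiftMat u k) _).1, h k (by omega)]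
    simp only [shiftSq_succ]
    ring

/-- A relation between neighbouring tails that makes the recursion of the denominators close. -/
theorem shiftTail_relation (u : ℤ[X]) (k : ℕ)
    (h : ∀ j < k, shiftMat u j 0 0 = -(shiftSq u j * (shiftSq u (j + 2) - 1))) :
    shiftTail u (k + 1) 1 0 * (shiftSq u k * shiftSq u (k + 1)) +
        (shiftSq u (k + 1) * shiftSq u (k + 2)) * shiftTail u k 0 1 =
      shiftSq u k * shiftSq u (k + 1) + shiftSq u (k + 1) * shiftSq u (k + 2) -
        shiftSq u k * shiftSq u (k + 1) * (shiftSq u k - 1) * (shiftSq u (k + 1) - 1) := by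
  match k with
  | 0 =>
    simp [shiftTail, quotientMat, Matrix.mul_apply, shiftSq]
    ring
  | 1 =>
    have h1 := mirrorMat_apply (det_shiftMat u 0) ((shiftSq u 0 - 2) ^ 2)
    rw [(shiftMat_zero_apply u).1, (shiftMat_zero_apply u).2] at h1
    change mirrorMat (shiftMat u 0) ((shiftSq u 0 - 2) ^ 2) 1 0 * _ + _ = _
    rw [h1.2.2.1]
    simp [shiftTail, quotientMat, Matrix.mul_apply, shiftSq]
    ring
  | k + 2 =>
    have e1 := (mirrorMat_apply (det_shiftMat u k) ((shiftSq u k - 2) ^ 2)).2.1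
    have e2 := (mirrorMat_apply (det_shiftMat u (k + 1)) ((shiftSq u (k + 1) - 2) ^ 2)).2.2.1
    have e3 := (shiftMat_succ_apply u k).2.2
    rw [shiftTail_apply u k fun j hj => h j (by omega)] at e3
    have h0 := h k (by omega)
    have h1 := h (k + 1) (by omega)
    change mirrorMat (shiftMat u (k + 1)) ((shiftSq u (k + 1) - 2) ^ 2) 1 0 * _ +
      _ * mirrorMat (shiftMat u k) ((shiftSq u k - 2) ^ 2) 0 1 = _
    rw [h0, h1] at e3
    rw [e1, e2, h0, h1]
    simp only [shiftSq_succ] at e3 ⊢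
    generalize shiftSq u k = y at *
    generalize shiftMat u k 1 0 = p at *
    generalize shiftMat u (k + 1) 1 0 = p' at *
    -- The cross terms of the two mirrored tails combine to tt'qq'(qp' - q'p); the coefficient is
    -- -tt'qq', and `e3` supplies the value of the determinant-like factor.
    linear_combination (-((y - 2) ^ 2 * ((y - 1) ^ 2 - 2) ^ 2 * (y * (((y - 1) ^ 2 - 1) ^ 2 - 1)) *
      ((y - 1) ^ 2 * ((((y - 1) ^ 2 - 1) ^ 2 - 1) ^ 2 - 1)))) * e3

theorem shiftMat_apply (u : ℤ[X]) (hu : u.natDegree = 1) (k : ℕ) :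
    shiftMat u k 0 0 = -(shiftSq u k * (shiftSq u (k + 2) - 1)) := by
  have hne : ∀ n, shiftSq u n ≠ 0 := by
    intro n h
    have h1 : (shiftSq u n).natDegree = 2 ^ n := by
      clear h
      induction n with
      | zero => simpa [shiftSq] using hu
      | succ n ih =>
        rw [shiftSq_succ, natDegree_pow, ← C_1, natDegree_sub_C, ih, pow_succ, mul_comm]
    rw [h, natDegree_zero] at h1
    exact (pow_pos two_pos n).ne h1
  induction k using Nat.strong_induction_on with
  | _ k ih =>
    match k with
    | 0 => simpa [shiftSq] using (shiftMat_zero_apply u).1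
    | 1 =>
      simp [shiftMat, quotientMat, Matrix.mul_apply, shiftSq]
      ring
    | k + 2 =>
      have hr := shiftTail_relation u k fun j hj => ih j (by omega)
      have e1 := (shiftMat_succ_apply u (k + 1)).1
      have e2 := (shiftMat_succ_apply u k).2.1
      have n1 := shiftTail_apply u (k + 1) fun j hj => ih j (by omega)
      have n0 := shiftTail_apply u k fun j hj => ih j (by omega)
      rw [n1, ih (k + 1) (by omega)] at e1
      rw [n0, ih (k + 1) (by omega), ih k (by omega)] at e2
      -- Multiplying by yₖyₖ₊₁, the corner entry of the earlier tail, lets `e2` eliminate the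
      -- unknown off-diagonal entry of `shiftMat u (k + 1)`.
      refine mul_left_cancel₀ (mul_ne_zero (hne k) (hne (k + 1))) ?_
      rw [e1]
      simp only [shiftSq_succ] at *
      generalize shiftSq u k = y at *
      linear_combination (-((y - 1) ^ 2 * ((((y - 1) ^ 2 - 1) ^ 2 - 1) ^ 2 - 1))) * hr +
        ((y - 1) ^ 2 * ((y - 1) ^ 2 - 1) ^ 2) * e2

theorem natDegree_shiftSq {u : ℤ[X]} (hu : u.natDegree = 1) (n : ℕ) :
    (shiftSq u n).natDegree = 2 ^ n := by
  induction n with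
  | zero => simpa [shiftSq] using hu
  | succ n ih => rw [shiftSq_succ, natDegree_pow, ← C_1, natDegree_sub_C, ih, pow_succ, mul_comm]

theorem shiftSq_ne_zero {u : ℤ[X]} (hu : u.natDegree = 1) (n : ℕ) : shiftSq u n ≠ 0 := by
  intro h
  have h1 := natDegree_shiftSq hu n
  rw [h, natDegree_zero] at h1
  exact (pow_pos two_pos n).ne h1

theorem shiftSq_sub_C_ne_zero {u : ℤ[X]} (hu : u.natDegree = 1) (n : ℕ) (c : ℤ) :
    shiftSq u n - C c ≠ 0 := by
  intro h
  have h1 := natDegree_shiftSq hu n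
  rw [← natDegree_sub_C (a := c), h, natDegree_zero] at h1
  exact (pow_pos two_pos n).ne h1

theorem isRegularMat_mirrorMat {A : Matrix (Fin 2) (Fin 2) ℤ[X]} (hA : IsRegularMat A) {t : ℤ[X]}
    (ht : t ≠ 0) : IsRegularMat (mirrorMat A t) :=
  hA.signConj.mul_quotient_mul ht hA.transpose

theorem isRegularMat_shift {u : ℤ[X]} (hu : u.natDegree = 1) (k : ℕ) :
    IsRegularMat (shiftMat u k) ∧ IsRegularMat (shiftTail u k) := by
  have h1 : IsRegularMat (quotientMat u) := .quotient (by omega)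
  have h2 : IsRegularMat (quotientMat (u - 1)) := .quotient (by rw [← C_1, natDegree_sub_C]; omega)
  have h3 : IsRegularMat (quotientMat (1 - u)) :=
    .quotient (by rw [← neg_sub, natDegree_neg, ← C_1, natDegree_sub_C]; omega)
  have h4 : IsRegularMat (quotientMat (-u)) := .quotient (by rw [natDegree_neg]; omega)
  have h5 : IsRegularMat (quotientMat ((u - 1) ^ 2)) :=
    .quotient (by rw [natDegree_pow, ← C_1, natDegree_sub_C]; omega)
  have h6 : IsRegularMat (quotientMat ((u - 1) ^ 2 - 1)) :=
    .quotient (by rw [← C_1, natDegree_sub_C, natDegree_pow, natDegree_sub_C]; omega)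
  have ht : ∀ k, (shiftSq u k - 2) ^ 2 ≠ 0 := fun k => pow_ne_zero 2 (shiftSq_sub_C_ne_zero hu k 2)
  induction k using Nat.strong_induction_on with
  | _ k ih =>
    constructor
    · match k with
      | 0 => exact ((h2.mul h3).mul h6).mul h1
      | k + 1 =>
        rw [shiftMat_succ]
        exact (ih k (by omega)).1.mul_quotient_mul (ht k) (ih k (by omega)).2
    · match k with
      | 0 => exact (h3.mul h4).mul h2
      | 1 => exact (((h3.mul h2).mul h5).mul h3).mul h2
      | k + 2 => exact isRegularMat_mirrorMat (ih k (by omega)).1 (ht k)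

theorem isRegularSeq_shiftMat {u : ℤ[X]} (hu : u.natDegree = 1) : IsRegularSeq (shiftMat u) :=
  ⟨(isRegularMat_shift hu 0).1, fun n => ⟨_, (isRegularMat_shift hu n).2,
    Or.inr ⟨_, pow_ne_zero 2 (shiftSq_sub_C_ne_zero hu n 2), shiftMat_succ u n⟩⟩⟩

/-- The numerator of the error term in the approximation of `∑ 1 / yₙ` for `yₙ₊₁ = (yₙ - 1)²`. -/
def shiftNum (y : ℤ[X]) : ℤ[X] :=
  1 + (y - 1) + (y - 1) ^ 2 - (y - 1) ^ 3 - (y - 1) ^ 4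

theorem natDegree_shiftNum_le (y : ℤ[X]) : (shiftNum y).natDegree ≤ 4 * y.natDegree := by
  have h : shiftNum y = (1 + (X - 1) + (X - 1) ^ 2 - (X - 1) ^ 3 - (X - 1) ^ 4 : ℤ[X]).comp y := by
    simp [shiftNum]
  rw [h]
  refine natDegree_comp_le.trans (Nat.mul_le_mul_right _ ?_)
  compute_degree

/-- Successive convergents differ by 1/((yₙ₊₂ - 1)(yₙ₊₃ - 1)), and the correction term changes by
the same amount minus 1/yₙ. -/
theorem sum_shiftSq {u : ℤ[X]} (hu : u.natDegree = 1) (n : ℕ) :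
    ∑ i ∈ Finset.range n, atInfinity 1 / atInfinity (shiftSq u i) +
      atInfinity (shiftNum (shiftSq u n)) / atInfinity (shiftMat u n 0 0) =
        atInfinity (shiftMat u n 1 0) / atInfinity (shiftMat u n 0 0) := by
  have hne : ∀ k, shiftMat u k 0 0 ≠ 0 := by
    intro k
    rw [shiftMat_apply u hu, neg_ne_zero]
    exact mul_ne_zero (shiftSq_ne_zero hu k) (by simpa using shiftSq_sub_C_ne_zero hu (k + 2) 1)
  induction n with
  | zero =>
    rw [(shiftMat_zero_apply u).2]
    simp [shiftNum, shiftSq]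
  | succ n ih =>
    have hD : (shiftSq u (n + 2) - 1) * (shiftSq u (n + 3) - 1) ≠ 0 :=
      mul_ne_zero (by simpa using shiftSq_sub_C_ne_zero hu (n + 2) 1)
        (by simpa using shiftSq_sub_C_ne_zero hu (n + 3) 1)
    have h1 := atInfinity_div_eq_add (d := 1) (hne n) (hne (n + 1)) hD (p := shiftMat u n 1 0)
      (p' := shiftMat u (n + 1) 1 0) (by
        rw [(shiftMat_succ_apply u n).2.2, shiftTail_apply u n fun j _ => shiftMat_apply u hu j,
          shiftMat_apply u hu, shiftMat_apply u hu]
        ring)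
    have hy := shiftSq_ne_zero hu n
    have h2 := atInfinity_div_eq_add
      (d := shiftSq u n - (shiftSq u (n + 2) - 1) * (shiftSq u (n + 3) - 1))
      (hne n) (hne (n + 1)) (mul_ne_zero hD hy) (p := shiftNum (shiftSq u n))
      (p' := shiftNum (shiftSq u (n + 1))) (by
        rw [shiftMat_apply u hu, shiftMat_apply u hu]
        simp only [shiftNum, shiftSq_succ]
        ring)
    have hD' := atInfinity_ne_zero hD
    have hy' := atInfinity_ne_zero hy
    have h3 : atInfinity (shiftSq u n - (shiftSq u (n + 2) - 1) * (shiftSq u (n + 3) - 1)) /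
        atInfinity ((shiftSq u (n + 2) - 1) * (shiftSq u (n + 3) - 1) * shiftSq u n) =
        atInfinity 1 / atInfinity ((shiftSq u (n + 2) - 1) * (shiftSq u (n + 3) - 1)) -
          atInfinity 1 / atInfinity (shiftSq u n) := by
      generalize (shiftSq u (n + 2) - 1) * (shiftSq u (n + 3) - 1) = D at *
      rw [map_sub, map_mul, map_one]
      field_simp
    rw [Finset.sum_range_succ, h1, ← ih, h2, h3]
    ring

theorem polyIterate_eq_shiftSq {e : ℤ} (he : e * e = 1) (n : ℕ) :
    polyIterate (C e * (X - C e) ^ 2) n = C e * shiftSq (C e * X) n := by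
  have hC : (C e * C e : ℤ[X]) = 1 := by rw [← C_mul, he, C_1]
  induction n with
  | zero =>
    rw [polyIterate_zero, shiftSq_zero]
    linear_combination (-X : ℤ[X]) * hC
  | succ n ih =>
    rw [polyIterate_succ, ih, shiftSq_succ]
    simp only [mul_comp, C_comp, pow_comp, sub_comp, X_comp]
    linear_combination C e * (shiftSq (C e * X) n - 1) ^ 2 * hC

-- The iterates are e·yₙ with y₀ = ex, so the series is e times ∑ 1/yₙ. The correction has numerator
-- of degree at most 4·2ⁿ and denominator of degree 5·2ⁿ, hence tends to zero. For e = -1 all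
-- quotients are negated.
open WithZero in
theorem hasSpecializable_mul_sub_sq {e : ℤ} (he : e = 1 ∨ e = -1)
    (hf : (C e * (X - C e) ^ 2 : ℤ[X]).natDegree = 2) :
    HasSpecializableContFract (∑' n, iterTerm (C e * (X - C e) ^ 2) n) := by
  have hee : e * e = 1 := by rcases he with rfl | rfl <;> rfl
  have he0 : e ≠ 0 := by rintro rfl; simp at hee
  set f : ℤ[X] := C e * (X - C e) ^ 2
  have hu : (C e * X : ℤ[X]).natDegree = 1 := natDegree_C_mul_X e he0
  set M := shiftMat (C e * X) with hMdef
  have hM : ∀ n, M n 0 0 ≠ 0 := by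
    intro n
    rw [hMdef, shiftMat_apply _ hu, neg_ne_zero]
    exact mul_ne_zero (shiftSq_ne_zero hu n) (by simpa using shiftSq_sub_C_ne_zero hu (n + 2) 1)
  have hC : atInfinity (C e) * atInfinity (C e) = 1 := by rw [← map_mul, ← C_mul, hee, C_1, map_one]
  have hC0 := atInfinity_ne_zero (C_ne_zero.2 he0)
  have hlim : Tendsto (fun n => atInfinity (C e) * (atInfinity (M n 1 0) / atInfinity (M n 0 0)))
      atTop (𝓝 (∑' n, iterTerm f n)) := by
    refine (tendsto_sum_iterTerm_add hf (e := fun n => atInfinity (C e) *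
      (atInfinity (shiftNum (shiftSq (C e * X) n)) / atInfinity (M n 0 0))) fun n => ?_).congr
      fun n => ?_
    · have h1 : (M n 0 0).natDegree = 5 * 2 ^ n := by
        rw [hMdef, shiftMat_apply _ hu, natDegree_neg, natDegree_mul (shiftSq_ne_zero hu n)
          (by simpa using shiftSq_sub_C_ne_zero hu (n + 2) 1), ← C_1, natDegree_sub_C,
          natDegree_shiftSq hu, natDegree_shiftSq hu]
        ring
      have h2 := natDegree_shiftNum_le (shiftSq (C e * X) n)
      rw [natDegree_shiftSq hu] at h2
      rw [map_mul, map_div₀, val_atInfinity (C_ne_zero.2 he0), natDegree_C, val_atInfinity (hM n),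
        h1, ← mul_div_assoc]
      have h3 := val_atInfinity_le (n := 4 * 2 ^ n) (by exact_mod_cast h2)
      have h4 : (n : ℤ) ≤ 2 ^ n := by exact_mod_cast n.lt_two_pow_self.le
      rw [div_le_iff₀ (by simp)]
      simp only [Nat.cast_zero, exp_zero, one_mul]
      refine h3.trans ?_
      rw [← exp_add, exp_le_exp]
      push_cast
      linarith
    · rw [← sum_shiftSq hu, mul_add, Finset.mul_sum]
      congr 1
      refine Finset.sum_congr rfl fun i _ => ?_
      have := atInfinity_ne_zero (shiftSq_ne_zero hu i)
      rw [iterTerm_eq, polyIterate_eq_shiftSq hee, map_mul, map_one]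
      field_simp
      linear_combination -hC
  rcases he with rfl | rfl
  · refine (isRegularSeq_shiftMat hu).hasSpecializable (hlim.congr fun n => ?_)
    have h1 : atInfinity (C 1) = 1 := by rw [C_1, map_one]
    rw [h1, one_mul]
  · have h1 : Tendsto (fun n => atInfinity (M n 1 0) / atInfinity (M n 0 0)) atTop
        (𝓝 (-∑' n, iterTerm f n)) := by
      refine hlim.neg.congr fun n => ?_
      rw [C_neg, C_1, map_neg, map_one]
      ring
    have h2 := (isRegularSeq_shiftMat hu).hasSpecializable_neg h1
    rwa [neg_neg] at h2

theorem mainTheorem11 (f : ℤ[X]) (hf : f.natDegree = 2) :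
    Summable (iterTerm f) ∧
    (HasSpecializableContFract (∑' n : ℕ, iterTerm f n) ↔
      ((∃ k : ℤ, f = C k * X ^ 2) ∨
        (∃ k : ℤ, f = C k * X ^ 2 - X) ∨
        f = X ^ 2 - X + 1 ∨
        f = X ^ 2 - 2 * X + 1 ∨
        f = -X ^ 2 - X - 1 ∨
        f = -X ^ 2 - 2 * X - 1)) := by
  refine ⟨summable_iterTerm hf, eq_of_hasSpecializable hf, ?_⟩
  rintro (⟨k, rfl⟩ | ⟨k, rfl⟩ | h | h | h | h)
  · exact hasSpecializable_sq hf
  · exact hasSpecializable_sq_sub hf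
  · obtain rfl : f = C 1 * X ^ 2 - X + C 1 := by rw [h, C_1]; ring
    exact hasSpecializable_sq_sub_add (by norm_num) hf
  · obtain rfl : f = C 1 * (X - C 1) ^ 2 := by rw [h, C_1]; ring
    exact hasSpecializable_mul_sub_sq (Or.inl rfl) hf
  · obtain rfl : f = C (-1) * X ^ 2 - X + C (-1) := by rw [h, C_neg, C_1]; ring
    exact hasSpecializable_sq_sub_add (by norm_num) hf
  · obtain rfl : f = C (-1) * (X - C (-1)) ^ 2 := by rw [h, C_neg, C_1]; ring
    exact hasSpecializable_mul_sub_sq (Or.inr rfl) hf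

end
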